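/- Let $(\mathbb K,\mathbb F)$ be one of $(\mathbb R,\mathbb R)$, $(\mathbb R,\mathbb C)$, $(\mathbb C,\mathbb C)$. Functions depend on the odd-numbered variables $\mathbf t_o=(t_1,t_3,t_5,\dots)$, $t_n\in\mathbb K$, are defined on a set $U$ of such sequences that is open with respect to any finite number of the variables, have values in $\mathbb F$ (or matrices over $\mathbb F$), and are smooth ($C^\infty$ over $\mathbb K$) with respect to any finite number of the variables. Subscripts $t_n$ denote partial derivatives. *Odd Riccati hierarchy.* For constant matrices $L$ ($M\times M$), $Q$ ($N\times M$), $R$ ($N\times N$), $S$ ($M\times N$) over $\mathbb F$ put $$H=\begin{pmatrix}R&Q\\S&L\end{pmatrix},\qquad H^n=\begin{pmatrix}R_n&Q_n\\S_n&L_n\end{pmatrix}.$$ An $M\times N$ matrix function $\Phi$ solves the odd Riccati hierarchy if $\Phi_{t_n}=S_n+L_n\Phi-\Phi R_n-\Phi Q_n\Phi$ for all $n=1,3,5,\dots$. *BKP hierarchy.* A scalar function $\phi$ solves the BKP hierarchy if there is a formal pseudodifferential operator $\mathcal L=\partial+u_2\partial^{-1}+u_3\partial^{-2}+\cdots$ (where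 $\partial=\partial/\partial t_1$ and the $u_k$ are smooth scalar functions on $U$) such that $$\mathcal L_{t_n}=[(\mathcal L^n)_{\ge0},\mathcal L],\qquad \operatorname{res}(\mathcal L^n)=\phi_{t_n}\qquad (n=1,3,5,\dots),\qquad \partial\,\mathcal L+\mathcal L^*\,\partial=0 .$$ Here $(\ )_{\ge0}$ is the differential operator part, $\operatorname{res}$ is the coefficient of $\partial^{-1}$ (so $u_2=\phi_{t_1}$), and $\mathcal L^*$ is the formal adjoint, determined by $(a\,\partial^i)^*=(-\partial)^i a$. **Proposition 5.3.** Let $M=N$, and let $\Phi$ be a solution of the odd Riccati hierarchy with $$R=-L^{\intercal},\qquad S=S^{\intercal},\qquad Q=VV^{\intercal},$$ where $V$ is a constant $N$-component vector. If $\Phi$ satisfies $$S+L\,\Phi+\Phi^{\intercal}L^{\intercal}-\Phi^{\intercal}Q\,\Phi=0,$$ then $\phi=V^{\intercal}\,\Phi\,V$ solves the BKP hierarchy. -/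

import Mathlib

open scoped ContDiff Topology

noncomputable section

set_option linter.unusedSectionVars false

namespace BKP

/-! ## Functions of the odd-numbered times -/

/-- Index set of the odd-numbered variables `t₁, t₃, t₅, …`. -/
abbrev OddIdx : Type := {n : ℕ // Odd n}

/-- The points `(t₁, t₃, t₅, …)`. -/
abbrev Times (𝕜 : Type*) : Type _ := OddIdx → 𝕜

/-- `t + ∑_{n ∈ s} x_n e_n`: vary the finitely many coordinates in `s`. -/
def shift {𝕜 : Type*} [RCLike 𝕜] (t : Times 𝕜) (s : Finset OddIdx) (x : s → 𝕜) : Times 𝕜 :=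
  fun n => t n + if h : n ∈ s then x ⟨n, h⟩ else 0

/-- A domain for functions of infinitely many times: a set which is open with respect to any finite
number of the variables (the others being kept fixed).  In particular the whole space, the
sequences with finite support, the sequences for which `∑ |t_n| rⁿ` converges, and
subsets of these cut out by a condition such as `det X ≠ 0` are admitted. -/
structure TimeDomain (𝕜 : Type*) [RCLike 𝕜] where
  carrier : Set (Times 𝕜)
  isOpen_finite : ∀ t ∈ carrier, ∀ s : Finset OddIdx,
    ∀ᶠ x in 𝓝 (0 : s → 𝕜), shift t s x ∈ carrier

section Functions

variable {𝕜 F : Type*} [RCLike 𝕜] [RCLike F] [NormedAlgebra 𝕜 F]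

open Classical in
/-- Extension by zero of a function on the domain; only values near points of the domain, in finitely
many directions, are ever used. -/
def extZero (U : TimeDomain 𝕜) (f : U.carrier → F) : Times 𝕜 → F :=
  fun t => if h : t ∈ U.carrier then f ⟨t, h⟩ else 0

/-- Smoothness with respect to any finite number of the variables. -/
def IsSmooth (U : TimeDomain 𝕜) (f : U.carrier → F) : Prop :=
  ∀ t ∈ U.carrier, ∀ s : Finset OddIdx,
    ContDiffAt 𝕜 ∞ (fun x : s → 𝕜 => extZero U f (shift t s x)) 0

/-- The partial derivative `f_{t_n}`. -/
def partialDeriv (U : TimeDomain 𝕜) (n : OddIdx) (f : U.carrier → F) : U.carrier → F :=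
  fun t => lineDeriv 𝕜 (extZero U f) t (Pi.single n 1)

lemma extZero_apply (U : TimeDomain 𝕜) (f : U.carrier → F) {t : Times 𝕜} (h : t ∈ U.carrier) :
    extZero U f t = f ⟨t, h⟩ := by
  simp [extZero, h]

lemma shift_zero (t : Times 𝕜) (s : Finset OddIdx) : shift t s 0 = t := by
  funext n; simp [shift]

lemma extZero_add (U : TimeDomain 𝕜) (f g : U.carrier → F) (t : Times 𝕜) :
    extZero U (f + g) t = extZero U f t + extZero U g t := by
  by_cases h : t ∈ U.carrier <;> simp [extZero, h]

lemma extZero_mul (U : TimeDomain 𝕜) (f g : U.carrier → F) (t : Times 𝕜) :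
    extZero U (f * g) t = extZero U f t * extZero U g t := by
  by_cases h : t ∈ U.carrier <;> simp [extZero, h]

lemma IsSmooth.const (U : TimeDomain 𝕜) (c : F) : IsSmooth U (fun _ => c) := by
  intro t ht s
  refine (contDiffAt_const (c := c)).congr_of_eventuallyEq ?_
  filter_upwards [U.isOpen_finite t ht s] with x hx
  exact extZero_apply U _ hx

lemma IsSmooth.add {U : TimeDomain 𝕜} {f g : U.carrier → F} (hf : IsSmooth U f)
    (hg : IsSmooth U g) : IsSmooth U (f + g) := by
  intro t ht s
  simpa only [extZero_add] using (hf t ht s).add (hg t ht s)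

lemma IsSmooth.mul {U : TimeDomain 𝕜} {f g : U.carrier → F} (hf : IsSmooth U f)
    (hg : IsSmooth U g) : IsSmooth U (f * g) := by
  intro t ht s
  simpa only [extZero_mul] using (hf t ht s).mul (hg t ht s)

/-- Smooth functions are differentiable along each coordinate line. -/
lemma IsSmooth.lineDifferentiableAt {U : TimeDomain 𝕜} {f : U.carrier → F} (hf : IsSmooth U f)
    (n : OddIdx) (t : U.carrier) :
    LineDifferentiableAt 𝕜 (extZero U f) (t : Times 𝕜) (Pi.single n 1) := by
  have h := (hf t t.2 {n}).differentiableAt (by simp)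
  have key : (fun r : 𝕜 => extZero U f ((t : Times 𝕜) + r • Pi.single n (1 : 𝕜)))
      = (fun x : ({n} : Finset OddIdx) → 𝕜 => extZero U f (shift t {n} x)) ∘ fun r _ => r := by
    funext r
    simp only [Function.comp]
    congr 1
    funext m
    by_cases hm : m = n
    · subst hm; simp [shift]
    · simp [shift, hm]
  unfold LineDifferentiableAt
  rw [key]
  refine DifferentiableAt.comp (0 : 𝕜) ?_ (by fun_prop)
  exact h

lemma IsSmooth.partialDeriv {U : TimeDomain 𝕜} {f : U.carrier → F} (hf : IsSmooth U f)
    (n : OddIdx) : IsSmooth U (partialDeriv U n f) := by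
  classical
  intro t ht s
  let s' : Finset OddIdx := insert n s
  let g : (s' → 𝕜) → F := fun y => extZero U f (shift t s' y)
  have hg : ContDiffAt 𝕜 ∞ g 0 := hf t ht s'
  let j : (s → 𝕜) → (s' → 𝕜) := fun x m => if h : (m : OddIdx) ∈ s then x ⟨m, h⟩ else 0
  have hj : ContDiff 𝕜 ∞ j := by
    refine contDiff_pi.2 fun m => ?_
    by_cases h : (m : OddIdx) ∈ s
    · simp only [j, h, dite_true]; fun_prop
    · simp only [j, h, dite_false]; fun_prop
  have hj0 : j 0 = 0 := by funext m; simp [j]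
  let e : s' → 𝕜 := Pi.single ⟨n, Finset.mem_insert_self n s⟩ 1
  have hfd : ContDiffAt 𝕜 ∞ (fun x => fderiv 𝕜 g (j x) e) 0 := by
    have h1 : ContDiffAt 𝕜 ∞ (fderiv 𝕜 g) (j 0) := by
      rw [hj0]; exact hg.fderiv_right (m := ∞) (by simp)
    exact (h1.comp (0 : s → 𝕜) hj.contDiffAt).clm_apply contDiffAt_const
  refine hfd.congr_of_eventuallyEq ?_
  have hdiff : ∀ᶠ y in 𝓝 (j 0), DifferentiableAt 𝕜 g y := by
    rw [hj0]
    exact ((hg.of_le (m := 1) (by simp)).eventually (by simp)).mono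
      fun y hy => hy.differentiableAt (by simp)
  filter_upwards [U.isOpen_finite t ht s, hj.continuous.continuousAt.eventually hdiff] with x hx hd
  rw [extZero_apply U _ hx]
  have key : (fun r : 𝕜 => extZero U f (shift t s x + r • Pi.single n (1 : 𝕜)))
      = fun r : 𝕜 => g (j x + r • e) := by
    funext r
    simp only [g]
    congr 1
    funext m
    by_cases hm : m = n
    · subst hm
      by_cases hs : m ∈ s <;> simp [shift, s', j, e, hs, add_assoc]
    · by_cases hs : m ∈ s <;> simp [shift, s', j, e, hs, hm]
  change lineDeriv 𝕜 (extZero U f) (shift t s x) (Pi.single n 1) = _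
  rw [lineDeriv, key]
  exact hd.lineDeriv_eq_fderiv

/-- The algebra of smooth functions on the domain. -/
def smoothFunctions (F : Type*) [RCLike F] [NormedAlgebra 𝕜 F] (U : TimeDomain 𝕜) :
    Subalgebra F (U.carrier → F) where
  carrier := {f | IsSmooth U f}
  mul_mem' hf hg := IsSmooth.mul hf hg
  add_mem' hf hg := IsSmooth.add hf hg
  algebraMap_mem' c := IsSmooth.const U c

/-- Smooth `F`-valued functions on the domain. -/
abbrev SmoothFun (F : Type*) [RCLike F] [NormedAlgebra 𝕜 F] (U : TimeDomain 𝕜) : Type _ :=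
  smoothFunctions F U

/-- `∂/∂t_n` as a derivation of the algebra of smooth functions. -/
def dt (F : Type*) [RCLike F] [NormedAlgebra 𝕜 F] (U : TimeDomain 𝕜) (n : OddIdx) :
    Derivation F (SmoothFun F U) (SmoothFun F U) :=
  Derivation.mk'
    { toFun := fun f => ⟨partialDeriv U n f.1, IsSmooth.partialDeriv f.2 n⟩
      map_add' := by
        intro f g
        ext t
        have h : HasLineDerivAt 𝕜 (extZero U f.1 + extZero U g.1) _ (t : Times 𝕜)
            (Pi.single n 1) :=
          HasDerivAt.add (IsSmooth.lineDifferentiableAt f.2 n t).hasLineDerivAt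
            (IsSmooth.lineDifferentiableAt g.2 n t).hasLineDerivAt
        have e : extZero U (f + g : SmoothFun F U).1 = extZero U f.1 + extZero U g.1 :=
          funext (extZero_add U f.1 g.1)
        change lineDeriv 𝕜 (extZero U (f + g : SmoothFun F U).1) (t : Times 𝕜) _ = _
        rw [e]
        exact h.lineDeriv
      map_smul' := by
        intro c f
        ext t
        have e : (fun r : 𝕜 => extZero U (c • f : SmoothFun F U).1
            ((t : Times 𝕜) + r • Pi.single n (1 : 𝕜)))
            = fun r => c * extZero U f.1 ((t : Times 𝕜) + r • Pi.single n (1 : 𝕜)) := by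
          funext r
          by_cases h : (t : Times 𝕜) + r • Pi.single n (1 : 𝕜) ∈ U.carrier <;> simp [extZero, h]
        change lineDeriv 𝕜 (extZero U (c • f : SmoothFun F U).1) (t : Times 𝕜) _ = _
        rw [lineDeriv, e]
        exact deriv_const_mul c (IsSmooth.lineDifferentiableAt f.2 n t) }
    (by
      intro f g
      ext t
      have h1 : HasDerivAt _ _ (0 : 𝕜) :=
        (IsSmooth.lineDifferentiableAt f.2 n t).hasLineDerivAt
      have h2 : HasDerivAt _ _ (0 : 𝕜) :=
        (IsSmooth.lineDifferentiableAt g.2 n t).hasLineDerivAt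
      have h := (h1.mul h2).deriv
      have e : (fun r : 𝕜 => extZero U (f * g : SmoothFun F U).1
            ((t : Times 𝕜) + r • Pi.single n (1 : 𝕜)))
            = (fun r => extZero U f.1 ((t : Times 𝕜) + r • Pi.single n (1 : 𝕜)))
              * fun r => extZero U g.1 ((t : Times 𝕜) + r • Pi.single n (1 : 𝕜)) := by
        funext r
        exact extZero_mul U f.1 g.1 _
      change lineDeriv 𝕜 (extZero U (f * g : SmoothFun F U).1) (t : Times 𝕜) _ = _
      rw [lineDeriv, e, h]
      simp only [zero_smul, add_zero, extZero_apply U _ t.2]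
      change _ = f.1 t * lineDeriv 𝕜 (extZero U g.1) (t : Times 𝕜) (Pi.single n 1)
        + g.1 t * lineDeriv 𝕜 (extZero U f.1) (t : Times 𝕜) (Pi.single n 1)
      ring)

end Functions

/-! ## Formal pseudodifferential operators -/

/-- Formal pseudodifferential operators `∑_{i ≤ N} a_i ∂^i` with coefficients in `A`. -/
@[ext]
structure PsiDO (A : Type*) [CommRing A] where
  coeff : ℤ → A
  bounded : ∃ N : ℤ, ∀ i, N < i → coeff i = 0

namespace PsiDO

variable {R A : Type*} [CommRing R] [CommRing A] [Algebra R A]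

/-- The operator `∂^k`. -/
def D (A : Type*) [CommRing A] (k : ℤ) : PsiDO A where
  coeff i := if i = k then 1 else 0
  bounded := ⟨k, fun i hi => if_neg (by omega)⟩

lemma iterate_zero_eq (d : Derivation R A A) (k : ℕ) : d^[k] 0 = 0 :=
  Function.iterate_fixed (map_zero d) k

/-- Only finitely many terms contribute to a coefficient of a product. -/
lemma finite_support_mul (d : Derivation R A A) (P Q : PsiDO A) (m : ℤ) :
    (Function.support fun p : ℤ × ℕ =>
      (Ring.choose p.1 p.2 : ℤ) • (P.coeff p.1 * d^[p.2] (Q.coeff (m - p.1 + p.2)))).Finite := by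
  obtain ⟨M, hM⟩ := P.bounded
  obtain ⟨N, hN⟩ := Q.bounded
  refine ((Set.finite_Icc (m - N) M).prod (Set.finite_Iic (M + N - m).toNat)).subset ?_
  intro p hp
  have h1 : p.1 ≤ M := by
    by_contra h
    exact hp (by simp [hM _ (not_le.1 h)])
  have h2 : m - p.1 + p.2 ≤ N := by
    by_contra h
    exact hp (by simp [hN _ (not_le.1 h)])
  simp only [Set.mem_prod, Set.mem_Icc, Set.mem_Iic]
  omega

/-- Product of pseudodifferential operators, `∂` acting on coefficients as `d`:
`(a ∂^i) (b ∂^j) = ∑_{k ≥ 0} (i choose k) a d^k(b) ∂^{i+j-k}`. The pair `p` is `(i, k)`. -/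
def mul (d : Derivation R A A) (P Q : PsiDO A) : PsiDO A where
  coeff m := ∑ᶠ p : ℤ × ℕ,
    (Ring.choose p.1 p.2 : ℤ) • (P.coeff p.1 * d^[p.2] (Q.coeff (m - p.1 + p.2)))
  bounded := by
    obtain ⟨M, hM⟩ := P.bounded
    obtain ⟨N, hN⟩ := Q.bounded
    refine ⟨M + N, fun m hm => finsum_eq_zero_of_forall_eq_zero fun p => ?_⟩
    by_cases h : M < p.1
    · simp [hM _ h]
    · rw [hN _ (by omega), iterate_zero_eq]; simp

/-- Powers of a pseudodifferential operator. -/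
def pow (d : Derivation R A A) (P : PsiDO A) : ℕ → PsiDO A
  | 0 => D A 0
  | n + 1 => mul d (pow d P n) P

/-- Only finitely many terms contribute to a coefficient of the adjoint. -/
lemma finite_support_adjoint (d : Derivation R A A) (P : PsiDO A) (m : ℤ) :
    (Function.support fun k : ℕ =>
      (((m + k).negOnePow : ℤ) * Ring.choose (m + k) k) • d^[k] (P.coeff (m + k))).Finite := by
  obtain ⟨M, hM⟩ := P.bounded
  refine (Set.finite_Iic (M - m).toNat).subset ?_
  intro k hk
  have h1 : m + k ≤ M := by
    by_contra h
    exact hk (by simp [hM _ (not_le.1 h)])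
  simp only [Set.mem_Iic]
  omega

/-- The formal adjoint for commutative coefficients:
`(a ∂^i)^* = (-∂)^i a = (-1)^i ∑_{k ≥ 0} (i choose k) d^k(a) ∂^{i-k}`. -/
def adjoint (d : Derivation R A A) (P : PsiDO A) : PsiDO A where
  coeff m := ∑ᶠ k : ℕ,
    (((m + k).negOnePow : ℤ) * Ring.choose (m + k) k) • d^[k] (P.coeff (m + k))
  bounded := by
    obtain ⟨M, hM⟩ := P.bounded
    refine ⟨M, fun m hm => finsum_eq_zero_of_forall_eq_zero fun k => ?_⟩
    rw [hM _ (by omega), iterate_zero_eq, smul_zero]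

/-- The differential operator part `( )_{≥ 0}`. -/
def positivePart (P : PsiDO A) : PsiDO A where
  coeff i := if 0 ≤ i then P.coeff i else 0
  bounded := by
    obtain ⟨M, hM⟩ := P.bounded
    exact ⟨M, fun i hi => by simp [hM i hi]⟩

/-- The residue, i.e. the coefficient of `∂⁻¹`. -/
def res (P : PsiDO A) : A := P.coeff (-1)

end PsiDO

/-! ## The BKP hierarchy -/

/-- `L = ∂ + u₂ ∂⁻¹ + u₃ ∂⁻² + …` is a Lax operator of the BKP hierarchy with potential `φ`;
`δ n` is the derivation `∂/∂t_n`, and `∂ = ∂/∂t₁` is `δ 1`. -/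
structure IsBKPLax {R A : Type*} [CommRing R] [CommRing A] [Algebra R A]
    (δ : OddIdx → Derivation R A A) (φ : A) (L : PsiDO A) : Prop where
  coeff_one : L.coeff 1 = 1
  coeff_zero : L.coeff 0 = 0
  coeff_gt : ∀ i : ℤ, 1 < i → L.coeff i = 0
  /-- `res (L^n) = φ_{t_n}`; in particular `u₂ = φ_{t₁}`. -/
  potential : ∀ n : OddIdx, (PsiDO.pow (δ ⟨1, odd_one⟩) L n).res = δ n φ
  /-- `L_{t_n} = [B_n, L]` with `B_n = (L^n)_{≥ 0}`. -/
  lax : ∀ (n : OddIdx) (i : ℤ),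
    δ n (L.coeff i) =
      (PsiDO.mul (δ ⟨1, odd_one⟩) (PsiDO.pow (δ ⟨1, odd_one⟩) L n).positivePart L).coeff i
      - (PsiDO.mul (δ ⟨1, odd_one⟩) L (PsiDO.pow (δ ⟨1, odd_one⟩) L n).positivePart).coeff i
  /-- `∂ L + L^* ∂ = 0`. -/
  reduction : ∀ i : ℤ,
    (PsiDO.mul (δ ⟨1, odd_one⟩) (PsiDO.D A 1) L).coeff i
      + (PsiDO.mul (δ ⟨1, odd_one⟩) (PsiDO.adjoint (δ ⟨1, odd_one⟩) L) (PsiDO.D A 1)).coeff i = 0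

/-- The smooth function `φ` of the odd-numbered times solves the BKP hierarchy. -/
def SolvesBKPHierarchy {𝕜 F : Type*} [RCLike 𝕜] [RCLike F] [NormedAlgebra 𝕜 F]
    {U : TimeDomain 𝕜} (φ : SmoothFun F U) : Prop :=
  ∃ L : PsiDO (SmoothFun F U), IsBKPLax (dt F U) φ L

/-! ## The odd Riccati hierarchy -/

/-- A constant matrix as a matrix of constant functions. -/
abbrev constMatrix {𝕜 F : Type*} [RCLike 𝕜] [RCLike F] [NormedAlgebra 𝕜 F] (U : TimeDomain 𝕜)
    {m n : Type*} (B : Matrix m n F) : Matrix m n (SmoothFun F U) :=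
  B.map (algebraMap F (SmoothFun F U))

/-- `Φ_{t_n} = S_n + L_n Φ - Φ R_n - Φ Q_n Φ` for all odd `n`, where
`H^n = (R_n, Q_n; S_n, L_n)` for the block matrix `H = (R, Q; S, L)`. -/
def SolvesOddRiccati {𝕜 F : Type*} [RCLike 𝕜] [RCLike F] [NormedAlgebra 𝕜 F] {U : TimeDomain 𝕜}
    {M N : ℕ} (L : Matrix (Fin M) (Fin M) F) (Q : Matrix (Fin N) (Fin M) F)
    (R : Matrix (Fin N) (Fin N) F) (S : Matrix (Fin M) (Fin N) F)
    (Φ : Matrix (Fin M) (Fin N) (SmoothFun F U)) : Prop :=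
  ∀ n : OddIdx,
    Φ.map (dt F U n) =
      constMatrix U (Matrix.fromBlocks R Q S L ^ (n : ℕ)).toBlocks₂₁
      + constMatrix U (Matrix.fromBlocks R Q S L ^ (n : ℕ)).toBlocks₂₂ * Φ
      - Φ * constMatrix U (Matrix.fromBlocks R Q S L ^ (n : ℕ)).toBlocks₁₁
      - Φ * constMatrix U (Matrix.fromBlocks R Q S L ^ (n : ℕ)).toBlocks₁₂ * Φ

end BKP

end

open scoped ContDiff Topology

noncomputable section

set_option linter.unusedSectionVars false

namespace BKP

/-! ### The ring of formal pseudodifferential operators -/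

namespace PsiDO

variable {R A : Type*} [CommRing R] [CommRing A] [Algebra R A]

/-! The solution is obtained by dressing. Write `∂ = ∂/∂t₁`, let `χ = (∂ + Lᵀ)⁻¹V`, a column of
operators with constant coefficients, and put `W = 1 - VᵀΦχ = 1 - φ∂⁻¹ + ⋯`. The Lax operator is `𝓛
= W∂W⁻¹`.

Evolution. The Riccati equation linearizes: the column `η = (χ, Φχ)` satisfies `∂η = Hη + (V, ΦV)W`,
because the rank-one form `Q = VVᵀ` turns the quadratic term into part of a right multiple of `W`.
As `H` is constant, iteration gives `∂ⁿη = Hⁿη + EW` with differential operators as entries of `E`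
(`exists_pow_mul_eq`). The right hand side of the `n`-th Riccati equation is the row `(-Φ, 1)` times
`Hⁿ` times the column `(1, Φ)`, hence `W_{t_n} = BW - W∂ⁿ` for a differential operator `B`
(`exists_dressing_evolution`). Then `W_{t_n}W⁻¹ = B - 𝓛ⁿ` has negative order, so `B = (𝓛ⁿ)_{≥0}`;
the Lax equations follow, and the coefficient of `∂⁻¹` gives `res 𝓛ⁿ = φ_{t_n}`.

Reduction. `∂𝓛 + 𝓛*∂ = 0` follows once `W*∂W` commutes with `∂`. The algebraic constraint on `Φ`
yields `W*∂W = ∂ + χ*S∂χ` (`conjugated_derivative_identity`), and the right side has constant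
coefficients.

All of this takes place over a commutative algebra whose derivations commute with `∂`; the only
analytic input is the symmetry of second derivatives (`dt_comm`). -/

/-- Formal pseudodifferential operators, with `∂` acting on the coefficients as `d`. -/
def Alg (_d : Derivation R A A) : Type _ := PsiDO A

namespace Alg

variable {d : Derivation R A A}

/-- The coefficient of `∂^i`. -/
def coeff (P : Alg d) (i : ℤ) : A := PsiDO.coeff P i

@[ext]
lemma ext {P Q : Alg d} (h : ∀ i, P.coeff i = Q.coeff i) : P = Q :=
  PsiDO.ext (funext h)

/-- `P` has order at most `K`. -/
def OrderLE (P : Alg d) (K : ℤ) : Prop := ∀ i, K < i → P.coeff i = 0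

lemma exists_orderLE (P : Alg d) : ∃ K, OrderLE P K := PsiDO.bounded P

lemma OrderLE.mono {P : Alg d} {K K' : ℤ} (h : OrderLE P K) (hK : K ≤ K') : OrderLE P K' :=
  fun i hi => h i (by omega)

instance : Zero (Alg d) := ⟨⟨fun _ => 0, 0, fun _ _ => rfl⟩⟩

instance : Add (Alg d) :=
  ⟨fun P Q => ⟨fun i => P.coeff i + Q.coeff i, by
    obtain ⟨M, hM⟩ := P.exists_orderLE
    obtain ⟨N, hN⟩ := Q.exists_orderLE
    exact ⟨max M N, fun i hi => by rw [hM i (by omega), hN i (by omega), add_zero]⟩⟩⟩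

instance : Neg (Alg d) :=
  ⟨fun P => ⟨fun i => -P.coeff i, by
    obtain ⟨M, hM⟩ := P.exists_orderLE
    exact ⟨M, fun i hi => by rw [hM i hi, neg_zero]⟩⟩⟩

@[simp] lemma coeff_zero (i : ℤ) : (0 : Alg d).coeff i = 0 := rfl
@[simp] lemma coeff_add (P Q : Alg d) (i : ℤ) : (P + Q).coeff i = P.coeff i + Q.coeff i := rfl
@[simp] lemma coeff_neg (P : Alg d) (i : ℤ) : (-P).coeff i = -P.coeff i := rfl

instance : AddCommGroup (Alg d) where
  add_assoc P Q S := by ext i; simp [add_assoc]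
  zero_add P := by ext i; simp
  add_zero P := by ext i; simp
  add_comm P Q := by ext i; simp [add_comm]
  neg_add_cancel P := by ext i; simp
  nsmul := nsmulRec
  zsmul := zsmulRec

/-- The coefficient of `∂^i` as an additive map. -/
def coeffHom (i : ℤ) : Alg d →+ A where
  toFun P := P.coeff i
  map_zero' := rfl
  map_add' _ _ := rfl

@[simp] lemma coeff_sub (P Q : Alg d) (i : ℤ) : (P - Q).coeff i = P.coeff i - Q.coeff i :=
  map_sub (coeffHom i) P Q

@[simp] lemma coeff_sum {ι : Type*} (s : Finset ι) (f : ι → Alg d) (i : ℤ) :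
    (∑ j ∈ s, f j).coeff i = ∑ j ∈ s, (f j).coeff i :=
  map_sum (coeffHom i) f s

lemma OrderLE.neg {P : Alg d} {K : ℤ} (hP : OrderLE P K) : OrderLE (-P) K :=
  fun i hi => by rw [coeff_neg, hP i hi, neg_zero]

lemma OrderLE.sub {P Q : Alg d} {K : ℤ} (hP : OrderLE P K) (hQ : OrderLE Q K) :
    OrderLE (P - Q) K := fun i hi => by rw [coeff_sub, hP i hi, hQ i hi, sub_zero]

/-- The operator `a ∂^i`. -/
def monomial (a : A) (i : ℤ) : Alg d where
  coeff j := if j = i then a else 0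
  bounded := ⟨i, fun _ hj => if_neg (by omega)⟩

lemma coeff_monomial (a : A) (i j : ℤ) :
    (monomial a i : Alg d).coeff j = if j = i then a else 0 := rfl

lemma orderLE_monomial (a : A) (i : ℤ) : OrderLE (monomial a i : Alg d) i :=
  fun _ hj => if_neg (by omega)

lemma monomial_add (a b : A) (i : ℤ) :
    (monomial (a + b) i : Alg d) = monomial a i + monomial b i := by
  ext j; simp only [coeff_add, coeff_monomial]; split_ifs <;> simp

/-- Subtracting its leading terms lowers the order of an operator. -/
lemma orderLE_sub_sum_monomial {P : Alg d} {M : ℤ} (hM : OrderLE P M) (K : ℤ) :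
    OrderLE (P - ∑ i ∈ Finset.Ioc K M, monomial (P.coeff i) i) K := by
  intro j hj
  simp only [coeff_sub, coeff_sum, coeff_monomial, Finset.sum_ite_eq, Finset.mem_Ioc]
  split_ifs with h
  · exact sub_self _
  · rw [hM j (by omega), sub_zero]

/-- Additive maps which respect the filtration by order are determined by their values on
monomials. -/
lemma addHom_ext {f g : Alg d →+ Alg d} {c : ℤ}
    (hf : ∀ P K, OrderLE P K → OrderLE (f P) (K + c))
    (hg : ∀ P K, OrderLE P K → OrderLE (g P) (K + c))
    (h : ∀ a i, f (monomial a i) = g (monomial a i)) (P : Alg d) : f P = g P := by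
  obtain ⟨M, hM⟩ := P.exists_orderLE
  ext m
  -- The tail has order at most `m - c - 1`, so its images have order at most `m - 1` and do not
  -- reach the coefficient of `∂^m`. What remains is a finite sum of monomials.
  have hlow := orderLE_sub_sum_monomial hM (m - c - 1)
  set T := ∑ i ∈ Finset.Ioc (m - c - 1) M, monomial (d := d) (P.coeff i) i with hT
  have hfg : f T = g T := by simp only [hT, map_sum, h]
  have h1 := hf _ _ hlow m (by omega)
  have h2 := hg _ _ hlow m (by omega)
  rw [map_sub, coeff_sub, sub_eq_zero] at h1 h2
  rw [h1, h2, hfg]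

instance : One (Alg d) := ⟨monomial 1 0⟩

lemma one_def : (1 : Alg d) = monomial 1 0 := rfl

/-- Definitionally the product `PsiDO.mul`, so identities in this ring transfer to the
coefficientwise conditions of `IsBKPLax` by unfolding. -/
instance : Mul (Alg d) := ⟨fun P Q => PsiDO.mul d P Q⟩

lemma coeff_mul (P Q : Alg d) (m : ℤ) :
    (P * Q).coeff m = ∑ᶠ p : ℤ × ℕ,
      (Ring.choose p.1 p.2 : ℤ) • (P.coeff p.1 * d^[p.2] (Q.coeff (m - p.1 + p.2))) := rfl

lemma finite_support_coeff_mul (P Q : Alg d) (m : ℤ) :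
    (Function.support fun p : ℤ × ℕ =>
      (Ring.choose p.1 p.2 : ℤ) • (P.coeff p.1 * d^[p.2] (Q.coeff (m - p.1 + p.2)))).Finite :=
  finite_support_mul d P Q m

lemma iterate_add (k : ℕ) (a b : A) : d^[k] (a + b) = d^[k] a + d^[k] b :=
  iterate_map_add d k a b

lemma iterate_const {c : A} (hc : d c = 0) {k : ℕ} (hk : k ≠ 0) : d^[k] c = 0 := by
  obtain ⟨k, rfl⟩ := Nat.exists_eq_succ_of_ne_zero hk
  rw [Function.iterate_succ_apply, hc, iterate_zero_eq]

lemma OrderLE.mul {P Q : Alg d} {M N : ℤ} (hM : OrderLE P M) (hN : OrderLE Q N) :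
    OrderLE (P * Q) (M + N) := by
  intro m hm
  refine finsum_eq_zero_of_forall_eq_zero fun p => ?_
  by_cases h : M < p.1
  · change _ • (P.coeff p.1 * _) = 0
    rw [hM _ h, zero_mul, smul_zero]
  · change _ • (_ * d^[p.2] (Q.coeff _)) = 0
    rw [hN _ (by omega), iterate_zero_eq, mul_zero, smul_zero]

/-- The leading coefficient of a product. -/
lemma coeff_mul_of_orderLE {P Q : Alg d} {M N : ℤ} (hM : OrderLE P M) (hN : OrderLE Q N) :
    (P * Q).coeff (M + N) = P.coeff M * Q.coeff N := by
  rw [coeff_mul, finsum_eq_single _ (M, 0)]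
  · simp
  · rintro ⟨i, k⟩ hik
    by_cases h : M < i
    · simp only [hM _ h, zero_mul, smul_zero]
    · have : N < M + N - i + k := by
        by_contra h'
        exact hik (Prod.ext (by simp only; omega) (by simp only; omega))
      simp only [hN _ this, iterate_zero_eq, mul_zero, smul_zero]

protected lemma mul_add (P Q S : Alg d) : P * (Q + S) = P * Q + P * S := by
  ext m
  rw [coeff_add, coeff_mul, coeff_mul, coeff_mul,
    ← finsum_add_distrib (finite_support_coeff_mul P Q m) (finite_support_coeff_mul P S m)]
  refine finsum_congr fun p => ?_
  rw [coeff_add, iterate_add, mul_add, smul_add]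

protected lemma add_mul (P Q S : Alg d) : (P + Q) * S = P * S + Q * S := by
  ext m
  rw [coeff_add, coeff_mul, coeff_mul, coeff_mul,
    ← finsum_add_distrib (finite_support_coeff_mul P S m) (finite_support_coeff_mul Q S m)]
  refine finsum_congr fun p => ?_
  rw [coeff_add, add_mul, smul_add]

instance : NonUnitalNonAssocRing (Alg d) where
  left_distrib := Alg.mul_add
  right_distrib := Alg.add_mul
  zero_mul P := by
    have h := Alg.add_mul 0 0 P
    rwa [add_zero, left_eq_add] at h
  mul_zero P := by
    have h := Alg.mul_add P 0 0
    rwa [add_zero, left_eq_add] at h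

lemma coeff_monomial_mul (a : A) (i : ℤ) (Q : Alg d) (m : ℤ) :
    (monomial a i * Q).coeff m =
      ∑ᶠ k : ℕ, (Ring.choose i k : ℤ) • (a * d^[k] (Q.coeff (m - i + k))) := by
  rw [coeff_mul, finsum_curry _ (finite_support_coeff_mul (monomial a i : Alg d) Q m),
    finsum_eq_single _ i]
  · simp [coeff_monomial]
  · intro j hj
    simp [coeff_monomial, hj]

lemma finite_support_shift (Q : Alg d) (f : ℕ → A → A) (hf : ∀ k, f k 0 = 0) (m : ℤ) :
    (Function.support fun k : ℕ => f k (Q.coeff (m + k))).Finite := by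
  obtain ⟨N, hN⟩ := Q.exists_orderLE
  refine (Set.finite_Iic (N - m).toNat).subset fun k hk => ?_
  have : m + k ≤ N := by
    by_contra h
    exact hk (by simp only [hN _ (not_le.1 h), hf])
  simp only [Set.mem_Iic]
  omega

lemma finite_support_choose (Q : Alg d) (i m : ℤ) :
    (Function.support fun k : ℕ =>
      (Ring.choose i k : ℤ) • d^[k] (Q.coeff (m + k))).Finite :=
  finite_support_shift Q (fun k a => (Ring.choose i k : ℤ) • d^[k] a)
    (fun k => by simp only [iterate_zero_eq, smul_zero]) m

lemma coeff_D_mul (i : ℤ) (Q : Alg d) (m : ℤ) :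
    (monomial 1 i * Q).coeff m =
      ∑ᶠ k : ℕ, (Ring.choose i k : ℤ) • d^[k] (Q.coeff (m - i + k)) := by
  simp only [coeff_monomial_mul, one_mul]

@[simp] lemma coeff_C_mul (a : A) (Q : Alg d) (m : ℤ) :
    (monomial a 0 * Q).coeff m = a * Q.coeff m := by
  rw [coeff_monomial_mul, finsum_eq_single _ 0]
  · simp
  · intro k hk
    rw [Ring.choose_zero_pos ℤ (Nat.pos_of_ne_zero hk), zero_smul]

lemma coeff_D_one_mul (Q : Alg d) (m : ℤ) :
    (monomial 1 1 * Q).coeff m = d (Q.coeff m) + Q.coeff (m - 1) := by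
  rw [coeff_D_mul, finsum_eq_sum_of_support_subset (s := Finset.range 2)]
  · simp [Finset.sum_range_succ, add_comm]
  · intro k hk
    by_contra h
    simp only [Finset.coe_range, Set.mem_Iio, not_lt] at h
    apply hk
    have : Ring.choose (1 : ℤ) k = 0 := by
      have := Ring.choose_natCast (R := ℤ) 1 k
      rw [Nat.choose_eq_zero_of_lt (by omega)] at this
      exact_mod_cast this
    simp only [this, zero_smul]

lemma monomial_eq (a : A) (i : ℤ) : (monomial a i : Alg d) = monomial a 0 * monomial 1 i := by
  ext j
  simp [coeff_monomial]

lemma monomial_mul_eq (a : A) (i : ℤ) (Q : Alg d) :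
    monomial a i * Q = monomial a 0 * (monomial 1 i * Q) := by
  ext m
  rw [coeff_C_mul, coeff_D_mul, coeff_monomial_mul,
    mul_finsum' _ _ (finite_support_choose Q i (m - i))]
  exact finsum_congr fun k => by rw [mul_smul_comm]

lemma C_mul_assoc (a : A) (Q S : Alg d) :
    (monomial a 0 * Q) * S = monomial a 0 * (Q * S) := by
  ext m
  rw [coeff_C_mul, coeff_mul, coeff_mul, mul_finsum' _ _ (finite_support_coeff_mul Q S m)]
  refine finsum_congr fun p => ?_
  rw [coeff_C_mul, mul_smul_comm, mul_assoc]

/-- Multiplication by a constant monomial from the right. -/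
lemma coeff_mul_monomial (P : Alg d) {c : A} (hc : d c = 0) (j m : ℤ) :
    (P * monomial c j).coeff m = P.coeff (m - j) * c := by
  rw [coeff_mul, finsum_eq_single _ (m - j, 0)]
  · simp [coeff_monomial]
  · rintro ⟨i, k⟩ hik
    by_cases hk : k = 0
    · subst hk
      have : m - i ≠ j := fun h => hik (by rw [← h]; simp)
      simp [coeff_monomial, this]
    · simp only [coeff_monomial]
      split_ifs
      · rw [iterate_const hc hk, mul_zero, smul_zero]
      · rw [iterate_zero_eq, mul_zero, smul_zero]

lemma D_one_C_mul (b : A) (T : Alg d) :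
    monomial 1 1 * (monomial b 0 * T)
      = monomial (d b) 0 * T + monomial b 0 * (monomial 1 1 * T) := by
  ext m
  simp only [coeff_D_one_mul, coeff_C_mul, coeff_add, Derivation.leibniz, smul_eq_mul]
  ring

/-- Pascal's rule: after the `k = 0` term is split off, `choose (i+1) (k+1) = choose i k + choose i
(k+1)` matches the two terms of the Leibniz rule. -/
lemma D_one_mul_D_mul (i : ℤ) (Q : Alg d) :
    monomial 1 1 * (monomial 1 i * Q) = monomial 1 (i + 1) * Q := by
  ext m
  have hfin := finite_support_choose Q i (m - i)
  have hfin' := finite_support_choose Q i (m - 1 - i)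
  have hsplit : ∀ g : ℕ → A, (Function.support g).Finite →
      ∑ᶠ k, g k = g 0 + ∑ᶠ k, g (k + 1) := by
    intro g hg
    obtain ⟨n, hn⟩ := hg.bddAbove
    rw [finsum_eq_sum_of_support_subset (s := Finset.range (n + 2)) g,
      finsum_eq_sum_of_support_subset (s := Finset.range (n + 1)) (fun k => g (k + 1)),
      Finset.sum_range_succ']
    · ring
    · intro k hk
      have := hn hk
      simp only [Finset.coe_range, Set.mem_Iio]; omega
    · intro k hk
      have := hn hk
      simp only [Finset.coe_range, Set.mem_Iio]; omega
  have hmap : d (∑ᶠ k : ℕ, (Ring.choose i k : ℤ) • d^[k] (Q.coeff (m - i + k))) = _ :=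
    (d : A →ₗ[R] A).toAddMonoidHom.map_finsum hfin
  rw [coeff_D_one_mul, coeff_D_mul, coeff_D_mul, coeff_D_mul, hmap, hsplit _ hfin', hsplit _ (finite_support_choose Q (i + 1) (m - (i + 1)))]
  have hfin'' : (Function.support fun k : ℕ =>
      (Ring.choose i (k + 1) : ℤ) • d^[k + 1] (Q.coeff (m - 1 - i + (k + 1 : ℕ)))).Finite :=
    hfin'.preimage (f := fun k => k + 1) (by intro a _ b _ h; simpa using h)
  have hd : (Function.support fun k : ℕ => (d : A →ₗ[R] A).toAddMonoidHom
      ((Ring.choose i k : ℤ) • d^[k] (Q.coeff (m - i + k)))).Finite :=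
    hfin.subset fun k hk h => hk (by simp only at h; simp only [h, map_zero])
  rw [add_left_comm, ← finsum_add_distrib hd hfin'']
  congr 1
  · simp [sub_sub, add_comm]
  · refine finsum_congr fun k => ?_
    have e1 : m - (i + 1) + ((k + 1 : ℕ) : ℤ) = m - i + k := by push_cast; ring
    have e2 : m - 1 - i + ((k + 1 : ℕ) : ℤ) = m - i + k := by push_cast; ring
    rw [e1, e2, Ring.choose_succ_succ, add_smul, Function.iterate_succ_apply']
    congr 1
    exact map_zsmul (d : A →ₗ[R] A) _ _

/-- The leading coefficient of `∂P` is that of `P`, so `∂P = 0` forces the order of `P` down without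
end. This cancellation carries associativity over to negative powers of `∂`. -/
lemma D_one_mul_injective {P Q : Alg d}
    (h : (monomial 1 1 : Alg d) * P = monomial 1 1 * Q) : P = Q := by
  rw [← sub_eq_zero, ← mul_sub] at h
  rw [← sub_eq_zero]
  obtain ⟨N, hN⟩ := (P - Q).exists_orderLE
  have key : ∀ k : ℕ, (P - Q).OrderLE (N - k) := by
    intro k
    induction k with
    | zero => simpa using hN
    | succ k ih =>
      intro i hi
      push_cast at hi
      by_cases h' : N - k < i
      · exact ih i h'
      · have := congrArg (fun T => coeff T (i + 1)) h
        simp only [coeff_D_one_mul, coeff_zero] at this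
        rwa [ih (i + 1) (by omega), map_zero, zero_add, add_sub_cancel_right] at this
  ext i
  exact key (N - i + 1).toNat i (by omega)

/-- Both sides are additive in `Q` and respect the filtration, so monomials `b∂^j` suffice; there
`∂b = b∂ + d b` reduces the claim to `∂(∂^j S) = ∂^{j+1} S`. -/
lemma D_one_mul_assoc (Q S : Alg d) :
    (monomial 1 1 * Q) * S = monomial 1 1 * (Q * S) := by
  obtain ⟨N, hN⟩ := S.exists_orderLE
  refine addHom_ext (c := 1 + N)
    (f := (AddMonoidHom.mulRight S).comp (AddMonoidHom.mulLeft (monomial 1 1)))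
    (g := (AddMonoidHom.mulLeft (monomial 1 1)).comp (AddMonoidHom.mulRight S))
    (fun P K hP => ?_) (fun P K hP => ?_) (fun b j => ?_) Q
  · exact (((orderLE_monomial 1 1).mul hP).mul hN).mono (by omega)
  · exact ((orderLE_monomial 1 1).mul (hP.mul hN)).mono (by omega)
  · simp only [AddMonoidHom.comp_apply, AddMonoidHom.mulLeft, AddMonoidHom.coe_mk,
      ZeroHom.coe_mk, AddMonoidHom.mulRight_apply]
    have e : (monomial 1 1 * monomial b j : Alg d) = monomial (d b) j + monomial b (j + 1) := by
      ext m
      simp only [coeff_D_one_mul, coeff_add, coeff_monomial]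
      by_cases h1 : m = j
      · simp [h1]
      · simp [h1, sub_eq_iff_eq_add]
    rw [e, add_mul, monomial_mul_eq, monomial_mul_eq b (j + 1), monomial_mul_eq b j, D_one_C_mul,
      D_one_mul_D_mul]

lemma D_mul_assoc (i : ℤ) (Q S : Alg d) :
    (monomial 1 i * Q) * S = monomial 1 i * (Q * S) := by
  have h0 : ∀ T : Alg d, monomial 1 0 * T = T := fun T => by ext m; simp
  induction i using Int.induction_on with
  | zero => rw [h0, h0]
  | succ i ih => rw [← D_one_mul_D_mul, ← D_one_mul_D_mul, D_one_mul_assoc, ih]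
  | pred i ih =>
    apply D_one_mul_injective
    rw [← D_one_mul_assoc, D_one_mul_D_mul, D_one_mul_D_mul, sub_add_cancel, ih]

/-- By continuity in `P` for the order filtration, only `P = a∂^i` has to be treated, and `a` and
`∂^i` are handled separately. -/
protected lemma mul_assoc (P Q S : Alg d) : (P * Q) * S = P * (Q * S) := by
  obtain ⟨M, hM⟩ := Q.exists_orderLE
  obtain ⟨N, hN⟩ := S.exists_orderLE
  refine addHom_ext (c := M + N)
    (f := (AddMonoidHom.mulRight S).comp (AddMonoidHom.mulRight Q))
    (g := AddMonoidHom.mulRight (Q * S))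
    (fun P K hP => ?_) (fun P K hP => ?_) (fun a i => ?_) P
  · exact ((hP.mul hM).mul hN).mono (by omega)
  · exact hP.mul (hM.mul hN)
  · simp only [AddMonoidHom.comp_apply, AddMonoidHom.mulRight_apply]
    rw [monomial_mul_eq, C_mul_assoc, D_mul_assoc, ← monomial_mul_eq]

instance : Ring (Alg d) where
  mul_assoc := Alg.mul_assoc
  one_mul P := by ext m; rw [one_def, coeff_C_mul, one_mul]
  mul_one P := by
    ext m
    rw [one_def, coeff_mul_monomial P d.map_one_eq_zero, sub_zero, mul_one]
  __ := (inferInstance : NonUnitalNonAssocRing (Alg d))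

end Alg

end PsiDO

end BKP

/-! ### Adjoints, derivations, inverses and differential operators -/

namespace BKP

namespace PsiDO

namespace Alg

variable {R A : Type*} [CommRing R] [CommRing A] [Algebra R A] {d : Derivation R A A}

@[simp] lemma coeff_zsmul (n : ℤ) (P : Alg d) (i : ℤ) : (n • P).coeff i = n • P.coeff i :=
  map_zsmul (coeffHom i) n P

lemma monomial_mul_monomial (a : A) (i : ℤ) {c : A} (hc : d c = 0) (j : ℤ) :
    (monomial a i * monomial c j : Alg d) = monomial (a * c) (i + j) := by
  ext m
  rw [coeff_mul_monomial _ hc, coeff_monomial, coeff_monomial]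
  simp only [sub_eq_iff_eq_add, ite_mul, zero_mul]

lemma D_mul_D (i j : ℤ) : (monomial 1 i * monomial 1 j : Alg d) = monomial 1 (i + j) := by
  rw [monomial_mul_monomial _ _ d.map_one_eq_zero, one_mul]

/-- Functions as operators of order zero. -/
def C (d : Derivation R A A) : A →+* Alg d where
  toFun a := monomial a 0
  map_one' := rfl
  map_mul' a b := by ext m; rw [coeff_C_mul]; simp only [coeff_monomial, mul_ite, mul_zero]
  map_zero' := by ext m; simp [coeff_monomial]
  map_add' a b := monomial_add a b 0

lemma C_apply (a : A) : C d a = monomial a 0 := rfl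

lemma D_one_mul_C (a : A) : monomial 1 1 * C d a = C d a * monomial 1 1 + C d (d a) := by
  have h := D_one_C_mul (d := d) a 1
  rwa [mul_one, mul_one, mul_one, add_comm] at h

/-- Constants are central. -/
lemma C_mul_comm {c : A} (hc : d c = 0) (P : Alg d) : C d c * P = P * C d c := by
  ext m
  rw [C_apply, coeff_C_mul, coeff_mul_monomial P hc, sub_zero, mul_comm]

lemma monomial_eq_C_mul (a : A) (i : ℤ) : (monomial a i : Alg d) = C d a * monomial 1 i :=
  monomial_eq a i

/-! ### The formal adjoint -/

/-- The formal adjoint as an additive map. -/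
def adj (d : Derivation R A A) : Alg d →+ Alg d :=
  AddMonoidHom.mk' (fun P => PsiDO.adjoint d P) (by
    intro P Q
    ext m
    have hfin : ∀ S : Alg d, _ := fun S => finite_support_shift S
      (fun k a => (((m + k).negOnePow : ℤ) * Ring.choose (m + k) k) • d^[k] a)
      (fun k => by simp only [iterate_zero_eq, smul_zero]) m
    refine Eq.trans (finsum_congr fun k => ?_) (finsum_add_distrib (hfin P) (hfin Q))
    change _ • d^[k] ((P + Q).coeff _) = _
    rw [coeff_add, iterate_add, smul_add]
    rfl)

lemma coeff_adj (P : Alg d) (m : ℤ) :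
    (adj d P).coeff m = ∑ᶠ k : ℕ,
      (((m + k).negOnePow : ℤ) * Ring.choose (m + k) k) • d^[k] (P.coeff (m + k)) := rfl

lemma OrderLE.adj {P : Alg d} {K : ℤ} (hP : OrderLE P K) : OrderLE (adj d P) K := by
  intro m hm
  rw [coeff_adj]
  refine finsum_eq_zero_of_forall_eq_zero fun k => ?_
  rw [hP _ (by omega), iterate_zero_eq, smul_zero]

lemma adj_monomial (b : A) (i : ℤ) :
    adj d (monomial b i) = (i.negOnePow : ℤ) • (monomial 1 i * C d b) := by
  ext m
  rw [coeff_zsmul, coeff_adj, coeff_D_mul, smul_finsum' _ (finite_support_choose _ i (m - i))]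
  refine finsum_congr fun k => ?_
  rw [C_apply, coeff_monomial, coeff_monomial, smul_smul]
  by_cases h : m + k = i
  · rw [if_pos h, if_pos (by omega), h]
  · rw [if_neg h, if_neg (by omega), iterate_zero_eq, smul_zero, smul_zero]

lemma adj_C (a : A) : adj d (C d a) = C d a := by
  rw [C_apply, adj_monomial, ← one_def, one_mul]
  simp [C_apply]

lemma adj_D (i : ℤ) : adj d (monomial 1 i) = (i.negOnePow : ℤ) • monomial 1 i := by
  rw [adj_monomial, map_one, mul_one]

lemma D_one_mul_monomial (b : A) (j : ℤ) :
    (monomial 1 1 * monomial b j : Alg d) = monomial (d b) j + monomial b (j + 1) := by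
  rw [monomial_eq_C_mul b j, ← mul_assoc, D_one_mul_C, add_mul, mul_assoc, D_mul_D,
    ← monomial_eq_C_mul, ← monomial_eq_C_mul, add_comm, add_comm 1 j]

lemma adj_D_one_mul (P : Alg d) : adj d (monomial 1 1 * P) = -(adj d P * monomial 1 1) := by
  refine addHom_ext (c := 1) (f := (adj d).comp (AddMonoidHom.mulLeft (monomial 1 1)))
    (g := -(AddMonoidHom.mulRight (monomial 1 1)).comp (adj d))
    (fun P K hP => ?_) (fun P K hP => ?_) (fun b j => ?_) P
  · exact (((orderLE_monomial 1 1).mul hP).mono (by omega)).adj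
  · exact (hP.adj.mul (orderLE_monomial 1 1)).neg
  · change adj d (monomial 1 1 * monomial b j) = -(adj d (monomial b j) * monomial 1 1)
    rw [D_one_mul_monomial, map_add, adj_monomial, adj_monomial, adj_monomial,
      Int.negOnePow_succ, ← D_mul_D j 1, mul_assoc, D_one_mul_C, mul_add]
    simp only [Units.val_neg, neg_smul, smul_add, smul_mul_assoc, mul_assoc]
    abel

lemma adj_D_mul (i : ℤ) (P : Alg d) :
    adj d (monomial 1 i * P) = (i.negOnePow : ℤ) • (adj d P * monomial 1 i) := by
  induction i using Int.induction_on with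
  | zero => rw [← one_def]; simp
  | succ i ih =>
    rw [add_comm, ← D_mul_D, mul_assoc, adj_D_one_mul, ih, add_comm, Int.negOnePow_succ,
      smul_mul_assoc, mul_assoc, D_mul_D, D_mul_D, add_comm, Units.val_neg, neg_smul]
  | pred i ih =>
    -- Downward step: the rule for `∂` is applied to `∂^{-i-1}P`, and the resulting right factor `∂`
    -- is removed with `∂⁻¹`.
    have h := adj_D_one_mul (monomial 1 (-i - 1) * P)
    rw [← mul_assoc, D_mul_D, add_sub_cancel, ih] at h
    have h' := congrArg (· * monomial 1 (-1)) h
    simp only [neg_mul, mul_assoc, smul_mul_assoc, D_mul_D, add_neg_cancel, ← one_def,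
      mul_one, ← sub_eq_add_neg] at h'
    rw [eq_neg_iff_add_eq_zero, add_comm, ← eq_neg_iff_add_eq_zero] at h'
    have e : Int.negOnePow (-i - 1) = -Int.negOnePow (-i) := by
      rw [Int.negOnePow_sub]; simp
    rw [h', e, Units.val_neg, neg_smul]

lemma adj_C_mul (a : A) (P : Alg d) : adj d (C d a * P) = adj d P * C d a := by
  refine addHom_ext (c := 0) (f := (adj d).comp (AddMonoidHom.mulLeft (C d a)))
    (g := (AddMonoidHom.mulRight (C d a)).comp (adj d))
    (fun P K hP => ?_) (fun P K hP => ?_) (fun b j => ?_) P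
  · exact (((orderLE_monomial a 0).mul hP).mono (by omega)).adj
  · exact hP.adj.mul (orderLE_monomial a 0)
  · change adj d (C d a * monomial b j) = adj d (monomial b j) * C d a
    rw [monomial_eq_C_mul, ← mul_assoc, ← map_mul, ← monomial_eq_C_mul, ← monomial_eq_C_mul,
      adj_monomial, adj_monomial, mul_comm a b, map_mul, smul_mul_assoc, mul_assoc]

lemma adj_mul (P Q : Alg d) : adj d (P * Q) = adj d Q * adj d P := by
  obtain ⟨N, hN⟩ := Q.exists_orderLE
  refine addHom_ext (c := N) (f := (adj d).comp (AddMonoidHom.mulRight Q))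
    (g := (AddMonoidHom.mulLeft (adj d Q)).comp (adj d))
    (fun P K hP => ?_) (fun P K hP => ?_) (fun b j => ?_) P
  · exact (hP.mul hN).adj
  · exact (hN.adj.mul hP.adj).mono (by omega)
  · change adj d (monomial b j * Q) = adj d Q * adj d (monomial b j)
    rw [adj_monomial, monomial_eq_C_mul, mul_assoc, adj_C_mul, adj_D_mul, smul_mul_assoc,
      mul_smul_comm, mul_assoc]

lemma adj_adj (P : Alg d) : adj d (adj d P) = P := by
  refine addHom_ext (c := 0) (f := (adj d).comp (adj d)) (g := AddMonoidHom.id _)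
    (fun P K hP => ?_) (fun P K hP => ?_) (fun b j => ?_) P
  · exact hP.adj.adj.mono (by omega)
  · exact hP.mono (by omega)
  · change adj d (adj d (monomial b j)) = monomial b j
    rw [adj_monomial, map_zsmul, adj_mul, adj_C, adj_D, mul_smul_comm, smul_smul,
      ← monomial_eq_C_mul, ← Units.val_mul, Int.units_mul_self, Units.val_one, one_smul]

/-- Makes the adjoint of a matrix of operators available as the conjugate transpose. -/
instance : StarRing (Alg d) where
  star P := adj d P
  star_involutive := adj_adj
  star_mul := adj_mul
  star_add := map_add (adj d)

lemma star_def (P : Alg d) : star P = adj d P := rfl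

@[simp] lemma star_C (a : A) : star (C d a) = C d a := adj_C a

lemma star_D_one : star (monomial 1 1 : Alg d) = -monomial 1 1 := by
  rw [star_def, adj_D]; simp

/-! ### Derivations acting on the coefficients -/

/-- A derivation of the coefficients, applied to each coefficient. -/
def der (δ : Derivation R A A) : Alg d →+ Alg d :=
  AddMonoidHom.mk' (fun P => (⟨fun i => δ (P.coeff i), by
    obtain ⟨N, hN⟩ := P.exists_orderLE
    exact ⟨N, fun i hi => by rw [hN i hi, map_zero]⟩⟩ : PsiDO A)) (by
    intro P Q
    ext m
    exact map_add δ _ _)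

@[simp] lemma coeff_der (δ : Derivation R A A) (P : Alg d) (i : ℤ) :
    (der δ P).coeff i = δ (P.coeff i) := rfl

lemma OrderLE.der {P : Alg d} {K : ℤ} (hP : OrderLE P K) (δ : Derivation R A A) :
    OrderLE (der δ P) K := fun i hi => by rw [coeff_der, hP i hi, map_zero]

lemma der_monomial (δ : Derivation R A A) (a : A) (i : ℤ) :
    der δ (monomial a i : Alg d) = monomial (δ a) i := by
  ext j; simp only [coeff_der, coeff_monomial]; split_ifs <;> simp

/-- The product involves iterates of `d`, so the Leibniz rule for `δ` requires `δ` to commute with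
`d`. -/
lemma der_mul {δ : Derivation R A A} (h : ∀ a, δ (d a) = d (δ a)) (P Q : Alg d) :
    der δ (P * Q) = der δ P * Q + P * der δ Q := by
  ext m
  have hk : ∀ (k : ℕ) a, δ (d^[k] a) = d^[k] (δ a) := fun k a =>
    (Function.Commute.iterate_right (f := δ) (g := d) h k) a
  have hmap : δ (∑ᶠ p : ℤ × ℕ,
      (Ring.choose p.1 p.2 : ℤ) • (P.coeff p.1 * d^[p.2] (Q.coeff (m - p.1 + p.2)))) = _ :=
    (δ : A →ₗ[R] A).toAddMonoidHom.map_finsum (finite_support_coeff_mul P Q m)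
  rw [coeff_add, coeff_der, coeff_mul, hmap, coeff_mul, coeff_mul,
    ← finsum_add_distrib (finite_support_coeff_mul _ _ m) (finite_support_coeff_mul _ _ m)]
  refine finsum_congr fun p => ?_
  rw [← smul_add]
  refine (map_zsmul (δ : A →ₗ[R] A) _ _).trans ?_
  congr 1
  change δ _ = _
  rw [δ.leibniz, hk, smul_eq_mul, smul_eq_mul, coeff_der, coeff_der]
  ring

/-- The commutator with `∂` differentiates the coefficients. -/
lemma der_eq_commutator (P : Alg d) : der d P = monomial 1 1 * P - P * monomial 1 1 := by
  ext m
  rw [coeff_sub, coeff_D_one_mul, coeff_mul_monomial P d.map_one_eq_zero, coeff_der, mul_one,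
    add_sub_cancel_right]

/-! ### Inverses -/

lemma eq_zero_of_forall_orderLE {P : Alg d} (h : ∀ K : ℕ, OrderLE P (-(K + 1))) : P = 0 := by
  ext i
  exact h (-i).toNat i (by omega)

lemma OrderLE.pow {T : Alg d} (hT : OrderLE T (-1)) (k : ℕ) : OrderLE (T ^ k) (-k) := by
  induction k with
  | zero => exact orderLE_monomial 1 0
  | succ k ih => rw [pow_succ]; exact (ih.mul hT).mono (by push_cast; omega)

lemma orderLE_sum {ι : Type*} (s : Finset ι) (f : ι → Alg d) {K : ℤ}
    (h : ∀ j ∈ s, OrderLE (f j) K) : OrderLE (∑ j ∈ s, f j) K := fun i hi => by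
  rw [coeff_sum]; exact Finset.sum_eq_zero fun j hj => h j hj i hi

/-- Operators `1 + T` with `T` of negative order are invertible. -/
lemma exists_inverse {T : Alg d} (hT : OrderLE T (-1)) :
    ∃ X : Alg d, (1 - T) * X = 1 ∧ X * (1 - T) = 1 ∧ OrderLE X 0 ∧ X.coeff 0 = 1 := by
  -- Partial sums of the geometric series. As `T^k` has order at most `-k`, the coefficient of `∂^i`
  -- is stable once all `k ≤ -i` are included, which explains the index `(-i).toNat + 1` in `X`.
  let S : ℕ → Alg d := fun n => ∑ k ∈ Finset.range n, T ^ k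
  have hS : ∀ m n : ℕ, m ≤ n → OrderLE (S n - S m) (-m) := by
    intro m n hmn
    simp only [S]
    rw [← Finset.sum_range_add_sum_Ico _ hmn, add_sub_cancel_left]
    exact orderLE_sum _ _ fun k hk => (hT.pow k).mono (by
      have := (Finset.mem_Ico.1 hk).1; omega)
  let X : Alg d := (⟨fun i => (S ((-i).toNat + 1)).coeff i, 0, fun i hi => by
    have : (-i).toNat = 0 := by omega
    change (S ((-i).toNat + 1)).coeff i = 0
    rw [this]
    simpa [S, one_def] using orderLE_monomial (d := d) 1 0 i hi⟩ : PsiDO A)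
  have hX : ∀ K : ℕ, OrderLE (X - S (K + 1)) (-(K + 1)) := by
    intro K i hi
    have := hS ((-i).toNat + 1) (K + 1) (by omega) i (by push_cast; omega)
    rw [coeff_sub] at this ⊢
    rw [sub_eq_zero] at this ⊢
    exact this.symm
  have h1 : OrderLE (1 - T) 0 := (orderLE_monomial 1 0).sub (hT.mono (by omega))
  have hr : (1 - T) * X = 1 := by
    rw [← sub_eq_zero]
    refine eq_zero_of_forall_orderLE fun K => ?_
    have e : (1 - T) * X - 1 = (1 - T) * (X - S (K + 1)) - T ^ (K + 1) := by
      rw [mul_sub, mul_neg_geom_sum]; abel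
    rw [e]
    exact ((h1.mul (hX K)).mono (by omega)).sub ((hT.pow (K + 1)).mono (by push_cast; omega))
  have hl : X * (1 - T) = 1 := by
    rw [← sub_eq_zero]
    refine eq_zero_of_forall_orderLE fun K => ?_
    have e : X * (1 - T) - 1 = (X - S (K + 1)) * (1 - T) - T ^ (K + 1) := by
      rw [sub_mul, geom_sum_mul_neg]; abel
    rw [e]
    exact (((hX K).mul h1).mono (by omega)).sub ((hT.pow (K + 1)).mono (by push_cast; omega))
  refine ⟨X, hr, hl, fun i hi => ?_, ?_⟩
  · have := hX 0 i (by push_cast; omega)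
    rw [coeff_sub, sub_eq_zero] at this
    rw [this]
    simpa [S, one_def] using orderLE_monomial (d := d) 1 0 i hi
  · change (S ((-0 : ℤ).toNat + 1)).coeff 0 = 1
    simp [S, one_def, coeff_monomial]

/-! ### Differential operators -/

/-- The ring of differential operators. -/
def diffOps (d : Derivation R A A) : Subring (Alg d) where
  carrier := {P | ∀ i < 0, P.coeff i = 0}
  mul_mem' {P Q} hP hQ m hm := by
    refine finsum_eq_zero_of_forall_eq_zero fun p => ?_
    change _ • (P.coeff p.1 * d^[p.2] (Q.coeff _)) = 0
    by_cases h : p.1 < 0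
    · rw [hP _ h, zero_mul, smul_zero]
    by_cases h' : m - p.1 + p.2 < 0
    · rw [hQ _ h', iterate_zero_eq, mul_zero, smul_zero]
    obtain ⟨n, hn⟩ := Int.eq_ofNat_of_zero_le (not_lt.1 h)
    -- Here `m < 0 ≤ m - n + p.2`, so the lower index exceeds the natural number `n`.
    have : Ring.choose p.1 p.2 = 0 := by
      rw [hn]
      have := Ring.choose_natCast (R := ℤ) n p.2
      rw [Nat.choose_eq_zero_of_lt (by omega)] at this
      exact_mod_cast this
    rw [this, zero_smul]
  one_mem' i hi := if_neg (by omega)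
  add_mem' hP hQ i hi := by rw [coeff_add, hP i hi, hQ i hi, add_zero]
  zero_mem' _ _ := rfl
  neg_mem' hP i hi := by rw [coeff_neg, hP i hi, neg_zero]

lemma monomial_mem_diffOps (a : A) {i : ℤ} (hi : 0 ≤ i) : (monomial a i : Alg d) ∈ diffOps d :=
  fun _ hj => if_neg (by omega)

lemma C_mem_diffOps (a : A) : C d a ∈ diffOps d := monomial_mem_diffOps a le_rfl

/-- An operator of negative order does not contribute to the differential operator part. -/
lemma positivePart_add {B T : Alg d} (hB : B ∈ diffOps d) (hT : OrderLE T (-1)) :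
    PsiDO.positivePart (B + T : Alg d) = B := by
  ext i
  change (if 0 ≤ i then (B + T).coeff i else 0) = B.coeff i
  split_ifs with h
  · rw [coeff_add, hT i (by omega), add_zero]
  · exact (hB i (by omega)).symm

lemma pow_eq (P : Alg d) (n : ℕ) : PsiDO.pow d P n = P ^ n := by
  induction n with
  | zero => rfl
  | succ n ih =>
    rw [pow_succ, ← ih]
    rfl

end Alg

end PsiDO

end BKP

namespace BKP

open Matrix

/-! ### Matrix identities over a noncommutative ring -/

section NoncommutativeMatrices

variable {𝓐 ι κ : Type*} [Ring 𝓐] [Fintype ι] [DecidableEq ι] [Fintype κ] [DecidableEq κ]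

/-- Lower half of the linearized Riccati system, with `f = Φ` and `W = 1 - v' f χ`. The terms `f r
χ` cancel, and the quadratic term joins `f v` to form `f v W`. -/
lemma derivative_column_identity {D f f' l s r : Matrix ι ι 𝓐} {χ v : Matrix ι κ 𝓐}
    {v' : Matrix κ ι 𝓐} (hχ : D * χ = r * χ + v) (hf : D * f = f * D + f')
    (hf' : f' = s + l * f - f * r - f * (v * v') * f) :
    D * (f * χ) = s * χ + l * (f * χ) + f * v * (1 - v' * f * χ) := by
  rw [← Matrix.mul_assoc, hf, Matrix.add_mul, Matrix.mul_assoc f, hχ, hf']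
  simp only [Matrix.mul_add, Matrix.add_mul, Matrix.sub_mul, Matrix.mul_sub, Matrix.mul_assoc,
    Matrix.mul_one]
  abel

lemma diagonal_mul_fromRows {m n : Type*} [Fintype m] [DecidableEq m] (P : 𝓐)
    (a : Matrix ι n 𝓐) (b : Matrix m n 𝓐) :
    diagonal (fun _ : ι ⊕ m => P) * fromRows a b
      = fromRows (diagonal (fun _ : ι => P) * a) (diagonal (fun _ : m => P) * b) := by
  ext (i | i) j <;> simp

lemma mul_apply_mem {α β γ : Type*} [Fintype β] {T : Subring 𝓐} {X : Matrix α β 𝓐}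
    {Y : Matrix β γ 𝓐} (hX : ∀ i j, X i j ∈ T) (hY : ∀ i j, Y i j ∈ T) (i : α) (j : γ) :
    (X * Y) i j ∈ T := by
  rw [mul_apply]
  exact T.sum_mem fun k _ => T.mul_mem (hX i k) (hY k j)

/-- Iterating a first order linear equation with a source in the left ideal generated by `W`. -/
lemma exists_pow_mul_eq {D H : Matrix ι ι 𝓐} (hDH : D * H = H * D) (T : Subring 𝓐)
    (hD : ∀ i j, D i j ∈ T) (hH : ∀ i j, H i j ∈ T) {η ζ : Matrix ι κ 𝓐} {W : Matrix κ κ 𝓐}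
    (hζ : ∀ i j, ζ i j ∈ T) (h : D * η = H * η + ζ * W) (n : ℕ) :
    ∃ E : Matrix ι κ 𝓐, (∀ i j, E i j ∈ T) ∧ D ^ n * η = H ^ n * η + E * W := by
  have hpow : ∀ n i j, (D ^ n) i j ∈ T := by
    intro n
    induction n with
    | zero =>
      intro i j
      rw [pow_zero, one_apply]
      split_ifs
      exacts [T.one_mem, T.zero_mem]
    | succ n ih =>
      intro i j
      rw [pow_succ]
      exact mul_apply_mem ih hD i j
  induction n with
  | zero => exact ⟨0, fun _ _ => T.zero_mem, by simp⟩
  | succ n ih =>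
    obtain ⟨E, hE, hn⟩ := ih
    refine ⟨H * E + D ^ n * ζ, fun i j => T.add_mem (mul_apply_mem hH hE i j) (mul_apply_mem (hpow n) hζ i j), ?_⟩
    have hc : D ^ n * H = H * D ^ n := (Commute.pow_left (show Commute D H from hDH) n).eq
    rw [pow_succ, Matrix.mul_assoc, h, Matrix.mul_add, ← Matrix.mul_assoc, hc, Matrix.mul_assoc, hn,
      pow_succ' H]
    simp only [Matrix.mul_add, Matrix.add_mul, Matrix.mul_assoc]
    abel

/-- Read with `f = Φ`, `g = Φᵀ`, `χ' = χ*` and `p = ∂`, this is `W*∂W = ∂ + χ*S∂χ`. The constraint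
`hB` trades `f` for `g` in `∂(fχ)`, up to an error `(f - g)vW` that `v'` annihilates by `hsym`; the
Riccati equation for `g` removes the remaining dependence on `Φ`. -/
lemma conjugated_derivative_identity {D f g f' g' l lt s : Matrix ι ι 𝓐} {χ v : Matrix ι κ 𝓐}
    {χ' v' : Matrix κ ι 𝓐} {p : Matrix κ κ 𝓐}
    (hχ : D * χ = -lt * χ + v) (hχ' : χ' * D = χ' * l - v')
    (hv : D * v = v * p) (hv' : p * v' = v' * D) (hlt : D * lt = lt * D)
    (hf : D * f = f * D + f') (hg : D * g = g * D + g')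
    (hf' : f' = s + l * f + f * lt - f * (v * v') * f)
    (hg' : g' = s + l * g + g * lt - g * (v * v') * g)
    (hB : s + l * f + g * lt - g * (v * v') * f = 0)
    (hsym : v' * f * v = v' * g * v) :
    (1 - χ' * g * v) * p * (1 - v' * f * χ) = p + χ' * s * (D * χ) := by
  set W := 1 - v' * f * χ with hW
  set W' := 1 - χ' * g * v with hW'
  have hvW : v * W = v - v * v' * f * χ := by
    rw [hW]; simp only [Matrix.mul_sub, Matrix.mul_one, Matrix.mul_assoc]
  have hDf : D * (f * χ) = g * (D * χ) + (f - g) * (v * W) := by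
    -- Subtracting the constraint from the Riccati equation factors the derivative as `f' = (f -
    -- g)(lt - v v' f)`.
    have e : f' = f' - (s + l * f + g * lt - g * (v * v') * f) := by rw [hB, sub_zero]
    rw [hf'] at e
    rw [← Matrix.mul_assoc, hf, hf', e, hvW, Matrix.add_mul, Matrix.mul_assoc f, hχ]
    simp only [Matrix.mul_add, Matrix.add_mul, Matrix.sub_mul, Matrix.mul_sub, Matrix.mul_assoc,
      Matrix.neg_mul, Matrix.mul_neg]
    abel
  have hWv : W' * v' = -(χ' * D - χ' * l + χ' * g * (v * v')) := by
    rw [hW', hχ']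
    simp only [Matrix.sub_mul, Matrix.one_mul, Matrix.mul_assoc]
    abel
  have hzero : W' * v' * ((f - g) * (v * W)) = 0 := by
    have : W' * v' * ((f - g) * (v * W)) = W' * ((v' * f * v - v' * g * v) * W) := by
      simp only [Matrix.sub_mul, Matrix.mul_sub, Matrix.mul_assoc]
    rw [this, hsym, sub_self, Matrix.zero_mul, Matrix.mul_zero]
  have hDDχ : D * (D * χ) = -lt * (D * χ) + v * p := by
    conv_lhs => rw [hχ]
    rw [Matrix.mul_add, hv, Matrix.neg_mul, Matrix.mul_neg, ← Matrix.mul_assoc, hlt,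
      Matrix.mul_assoc, Matrix.neg_mul]
  have hmain : W' * v' * (g * (D * χ)) = -(χ' * (g * (v * p)) + χ' * s * (D * χ)) := by
    have e1 : W' * v' * (g * (D * χ))
        = -(χ' * (D * g - l * g + g * (v * v') * g) * (D * χ)) := by
      rw [hWv]
      simp only [Matrix.add_mul, Matrix.sub_mul, Matrix.mul_sub, Matrix.mul_add, Matrix.mul_assoc,
        Matrix.neg_mul]
    have e2 : D * g - l * g + g * (v * v') * g = g * D + s + g * lt := by
      rw [hg, hg']; abel
    rw [e1, e2, Matrix.mul_add, Matrix.mul_add, Matrix.add_mul, Matrix.add_mul,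
      Matrix.mul_assoc χ' (g * D), Matrix.mul_assoc g D, hDDχ]
    simp only [Matrix.mul_add, Matrix.neg_mul, Matrix.mul_neg, Matrix.mul_assoc]
    abel
  have hpW : p * W = p - v' * (D * (f * χ)) := by
    rw [hW, Matrix.mul_sub, Matrix.mul_one, ← Matrix.mul_assoc p, ← Matrix.mul_assoc p, hv']
    simp only [Matrix.mul_assoc]
  rw [Matrix.mul_assoc, hpW, hDf, Matrix.mul_sub, ← Matrix.mul_assoc W' v', Matrix.mul_add, hzero,
    hmain, hW', Matrix.sub_mul, Matrix.one_mul]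
  simp only [Matrix.mul_assoc]
  abel

end NoncommutativeMatrices

/-! ### Matrices of operators and the resolvent column -/

namespace PsiDO

namespace Alg

variable {R A : Type*} [CommRing R] [CommRing A] [Algebra R A] {d : Derivation R A A}
  {m n ι : Type*}

/-- Scalars as operators of order zero. -/
def scalarHom (d : Derivation R A A) : R →+* Alg d := (C d).comp (algebraMap R A)

lemma scalarHom_comm (c : R) (P : Alg d) : scalarHom d c * P = P * scalarHom d c :=
  C_mul_comm (d.map_algebraMap c) P

/-- The matrix `∂ I`. -/
def diagD (d : Derivation R A A) (n : Type*) [DecidableEq n] : Matrix n n (Alg d) :=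
  diagonal fun _ => monomial 1 1

lemma diagD_pow (n : Type*) [Fintype n] [DecidableEq n] (k : ℕ) :
    diagD d n ^ k = diagonal fun _ => monomial 1 1 ^ k :=
  diagonal_pow _ k

variable [Fintype m] [DecidableEq m] [Fintype n] [DecidableEq n] [Fintype ι] [DecidableEq ι]

lemma diagD_mul_map_C (M : Matrix m n A) :
    diagD d m * M.map (C d) = M.map (C d) * diagD d n + (M.map d).map (C d) := by
  ext1 i j
  simp [diagD, D_one_mul_C]

lemma diagonal_mul_map_scalarHom (P : Alg d) (B : Matrix m n R) :
    diagonal (fun _ : m => P) * B.map (scalarHom d)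
      = B.map (scalarHom d) * diagonal fun _ : n => P := by
  ext1 i j
  simp [scalarHom_comm]

lemma diagonal_mul_of_der_eq_zero {χ : Matrix m n (Alg d)} (h : ∀ i j, der d (χ i j) = 0) (k : ℕ) :
    diagonal (fun _ : m => (monomial 1 1 : Alg d) ^ k) * χ
      = χ * diagonal fun _ : n => (monomial 1 1 : Alg d) ^ k := by
  ext1 i j
  rw [diagonal_mul, mul_diagonal]
  have := h i j
  rw [der_eq_commutator, sub_eq_zero] at this
  exact Commute.pow_left (show Commute (monomial 1 1) (χ i j) from this) k

lemma diagD_mul_of_der_eq_zero {χ : Matrix m n (Alg d)} (h : ∀ i j, der d (χ i j) = 0) :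
    diagD d m * χ = χ * diagD d n := by
  have := diagonal_mul_of_der_eq_zero h 1
  rwa [pow_one] at this

lemma conjTranspose_diagD (n : Type*) [DecidableEq n] : (diagD d n)ᴴ = -diagD d n := by
  ext1 i j
  rw [conjTranspose_apply, neg_apply, diagD, diagonal_apply, diagonal_apply]
  by_cases h : i = j
  · rw [if_pos h, if_pos h.symm, star_D_one]
  · rw [if_neg h, if_neg (Ne.symm h), star_zero, neg_zero]

lemma map_der_mul {δ : Derivation R A A} (h : ∀ a, δ (d a) = d (δ a)) {l : Type*}
    (M : Matrix l m (Alg d)) (N : Matrix m n (Alg d)) :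
    (M * N).map (der δ) = M.map (der δ) * N + M * N.map (der δ) := by
  ext1 i j
  simp only [Matrix.map_apply, Matrix.add_apply, mul_apply, map_sum, der_mul h,
    Finset.sum_add_distrib]

lemma map_der_map_scalarHom (δ : Derivation R A A) (B : Matrix m n R) :
    (B.map (scalarHom d)).map (der δ) = 0 := by
  ext1 i j
  have : der δ (scalarHom d (B i j)) = C d (δ (algebraMap R A (B i j))) := der_monomial δ _ 0
  rw [Matrix.map_apply, Matrix.map_apply, this, δ.map_algebraMap, map_zero]
  rfl

lemma map_der_map_C (δ : Derivation R A A) (M : Matrix m n A) :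
    (M.map (C d)).map (der δ) = (M.map δ).map (C d) := by
  ext1 i j
  exact der_monomial δ _ 0

lemma map_scalarHom (B : Matrix m n R) :
    B.map (scalarHom d) = (B.map (algebraMap R A)).map (C d) := rfl

/-- The resolvent column `(∂ - B)⁻¹ V = ∑_{k ≥ 0} B^k V ∂^{-1-k}`. -/
def resolvent (d : Derivation R A A) (B : Matrix n n R) (V : n → R) : Matrix n Unit (Alg d) :=
  of fun i _ => (⟨fun k => if k < 0 then algebraMap R A ((B ^ (-k - 1).toNat *ᵥ V) i) else 0, -1,
    fun k hk => if_neg (by omega)⟩ : PsiDO A)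

lemma coeff_resolvent (B : Matrix n n R) (V : n → R) (i : n) (u : Unit) (k : ℤ) :
    (resolvent d B V i u).coeff k
      = if k < 0 then algebraMap R A ((B ^ (-k - 1).toNat *ᵥ V) i) else 0 := rfl

lemma orderLE_resolvent (B : Matrix n n R) (V : n → R) (i : n) (u : Unit) :
    OrderLE (resolvent d B V i u) (-1) := fun k hk => if_neg (by omega)

lemma der_resolvent (δ : Derivation R A A) (B : Matrix n n R) (V : n → R) (i : n) (u : Unit) :
    der δ (resolvent d B V i u) = 0 := by
  ext k
  rw [coeff_der, coeff_resolvent]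
  split_ifs
  · rw [δ.map_algebraMap]; rfl
  · rw [map_zero]; rfl

/-- The coefficients are constant, so `∂` only shifts the geometric series; the shifted series is
`B` times the original plus the new term `V` at `∂^0`. -/
lemma diagD_mul_resolvent (B : Matrix n n R) (V : n → R) :
    diagD d n * resolvent d B V
      = B.map (scalarHom d) * resolvent d B V + (replicateCol Unit V).map (scalarHom d) := by
  ext i u k
  have hs : ∀ (c : R) (P : Alg d) (k : ℤ), (scalarHom d c * P).coeff k
      = algebraMap R A c * P.coeff k := fun c P k => coeff_C_mul _ P k
  have hV : (scalarHom d (V i)).coeff k = if k = 0 then algebraMap R A (V i) else 0 := rfl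
  have h0 : d ((resolvent d B V i u).coeff k) = 0 :=
    congrArg (fun P => coeff P k) (der_resolvent d B V i u)
  rw [diagD, Matrix.add_apply, diagonal_mul, coeff_add, coeff_D_one_mul, h0, zero_add]
  simp only [mul_apply, coeff_sum, Matrix.map_apply, hs, hV, replicateCol_apply, coeff_resolvent]
  rcases lt_trichotomy k 0 with hk | rfl | hk
  · obtain ⟨j, rfl⟩ : ∃ j : ℕ, k = -1 - j := ⟨(-1 - k).toNat, by omega⟩
    have e1 : (-(-1 - (j : ℤ) - 1) - 1).toNat = j + 1 := by omega
    have e2 : (-(-1 - (j : ℤ)) - 1).toNat = j := by omega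
    rw [e1, e2, if_pos (by omega), if_neg (by omega), add_zero]
    simp only [if_pos hk]
    rw [pow_succ', ← mulVec_mulVec, mulVec, dotProduct, map_sum]
    simp only [map_mul]
  · simp
  · rw [if_neg (by omega), if_neg (by omega)]
    simp [not_lt.2 hk.le]

end Alg

end PsiDO

end BKP

namespace BKP

open Matrix PsiDO PsiDO.Alg

/-! ### From dressing operators to Lax operators -/

section Dressing

variable {R A : Type*} [CommRing R] [CommRing A] [Algebra R A]

/-- A dressing operator `W` with `W_{t_n} = B_n W - W ∂^n`, for differential operators `B_n`, and
for which `W^* ∂ W` commutes with `∂`, yields a Lax operator `W ∂ W⁻¹` of the BKP hierarchy. -/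
lemma exists_isBKPLax_of_dressing {δ : OddIdx → Derivation R A A} {d : Derivation R A A}
    (hd : δ ⟨1, odd_one⟩ = d) (hδ : ∀ n a, δ n (d a) = d (δ n a))
    {W : Alg d} (hW : OrderLE (1 - W) (-1)) {φ : A} (hφ : (1 - W).coeff (-1) = φ)
    (hevol : ∀ n : OddIdx, ∃ B ∈ diffOps d,
      der (δ n) W = B * W - W * monomial 1 1 ^ (n : ℕ))
    (hstar : Commute (monomial 1 1) (star W * monomial 1 1 * W)) :
    ∃ L : PsiDO A, IsBKPLax δ φ L := by
  obtain ⟨X, hWX, hXW, hX, hX0⟩ := exists_inverse hW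
  rw [sub_sub_cancel] at hWX hXW
  have hderW : ∀ n, OrderLE (der (δ n) W) (-1) := fun n => by
    have : der (δ n) W = -der (δ n) (1 - W) := by
      rw [map_sub, one_def, der_monomial, (δ n).map_one_eq_zero]
      have h0 : (monomial 0 0 : Alg d) = 0 := map_zero (C d)
      rw [h0, zero_sub, neg_neg]
    rw [this]
    exact (hW.der _).neg
  have hresW : ∀ n, (der (δ n) W).coeff (-1) = -δ n φ := fun n => by
    have : W.coeff (-1) = -φ := by
      rw [← hφ, coeff_sub, one_def, coeff_monomial, if_neg (by omega), zero_sub, neg_neg]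
    rw [coeff_der, this, map_neg]
  have hneg : ∀ n, OrderLE (-(der (δ n) W * X)) (-1) := fun n =>
    (((hderW n).mul hX).mono (by omega)).neg
  set L : Alg d := W * monomial 1 1 * X with hL
  have hpow : ∀ n, L ^ n = W * monomial 1 1 ^ n * X := by
    intro n
    induction n with
    | zero => rw [pow_zero, pow_zero, mul_one, hWX]
    | succ n ih =>
      rw [pow_succ, ih, hL, pow_succ]
      calc W * monomial 1 1 ^ n * X * (W * monomial 1 1 * X)
          = W * monomial 1 1 ^ n * (X * W) * monomial 1 1 * X := by noncomm_ring
        _ = _ := by rw [hXW, mul_one]; noncomm_ring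
  have hB : ∀ n : OddIdx, ∃ B ∈ diffOps d, L ^ (n : ℕ) = B + -(der (δ n) W * X)
      ∧ der (δ n) W * X = B - L ^ (n : ℕ) := fun n => by
    obtain ⟨B, hB, h⟩ := hevol n
    have h' : der (δ n) W * X = B - L ^ (n : ℕ) := by
      rw [h, hpow, sub_mul, mul_assoc B, hWX, mul_one]
    exact ⟨B, hB, by rw [h']; abel, h'⟩
  -- Since `[∂, W] = W_{t₁}`, one has `𝓛 = ∂ - W_{t₁}W⁻¹`, which gives the required form of the
  -- nonnegative part.
  have hL1 : L = monomial 1 1 + -(der d W * X) := by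
    rw [der_eq_commutator, sub_mul, mul_assoc _ W, hWX, mul_one, hL]
    abel
  have hcoeff : ∀ i : ℤ, -1 < i → L.coeff i = if i = 1 then 1 else 0 := fun i hi => by
    have h1 := hneg ⟨1, odd_one⟩ i hi
    rw [hd] at h1
    rw [hL1, coeff_add, h1, add_zero, coeff_monomial]
  have hpos : ∀ n : OddIdx, ∃ B : Alg d,
      (PsiDO.pow d L n).positivePart = B ∧ der (δ n) W * X = B - L ^ (n : ℕ) := fun n => by
    obtain ⟨B, hB, h1, h2⟩ := hB n
    refine ⟨B, ?_, h2⟩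
    rw [pow_eq, h1]
    exact positivePart_add hB (hneg n)
  subst hd
  refine ⟨L, ⟨?_, ?_, ?_, ?_, ?_, ?_⟩⟩
  · exact hcoeff 1 (by omega)
  · exact hcoeff 0 (by omega)
  · intro i hi
    exact (hcoeff i (by omega)).trans (if_neg (by omega))
  · intro n
    obtain ⟨B, hB, h1, -⟩ := hB n
    rw [pow_eq, h1]
    -- Writing `-1` as `-1 + 0` exhibits the residue as the leading coefficient of a product of
    -- orders `-1` and `0`; `B` contributes nothing.
    change (B + -(der (δ n) W * X)).coeff (-1 + 0) = δ n φ
    rw [coeff_add, coeff_neg, coeff_mul_of_orderLE (hderW n) hX, hresW, hX0, mul_one, neg_neg,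
      add_zero, hB (-1) (by omega), zero_add]
  · intro n i
    obtain ⟨B, h1, h2⟩ := hpos n
    rw [h1]
    change (der (δ n) L).coeff i = (B * L).coeff i - (L * B).coeff i
    rw [← coeff_sub]
    congr 1
    -- The Lax equation comes from differentiating `𝓛W = W∂` and substituting `W_{t_n}W⁻¹ = B - 𝓛ⁿ`;
    -- the powers of `𝓛` cancel.
    have hLW : L * W = W * monomial 1 1 := by rw [hL, mul_assoc _ X, hXW, mul_one]
    have h3 := congrArg (der (δ n)) hLW
    have h0 : (monomial 0 1 : Alg (δ ⟨1, odd_one⟩)) = 0 := by ext j; simp [coeff_monomial]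
    rw [der_mul (hδ n) L W, der_mul (hδ n) W, der_monomial, (δ n).map_one_eq_zero, h0, mul_zero,
      add_zero] at h3
    have h4 := congrArg (· * X) h3
    simp only [add_mul] at h4
    rw [mul_assoc, hWX, mul_one, mul_assoc L, h2] at h4
    have h5 : der (δ n) W * monomial 1 1 * X = (B - L ^ (n : ℕ)) * L := by
      rw [← h2, hL]
      calc der (δ n) W * monomial 1 1 * X = der (δ n) W * 1 * monomial 1 1 * X := by rw [mul_one]
        _ = _ := by rw [← hXW]; noncomm_ring
    rw [h5, sub_mul, mul_sub, ← pow_succ, ← pow_succ'] at h4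
    rw [eq_sub_of_add_eq h4]
    abel
  · intro i
    change (monomial 1 1 * L).coeff i + (star L * monomial 1 1).coeff i = 0
    have hXs : star X * star W = 1 := by rw [← star_mul, hWX, star_one]
    have key : monomial 1 1 * L + star L * monomial 1 1 = 0 := by
      have e : star L = -(star X * monomial 1 1 * star W) := by
        rw [hL, star_mul, star_mul, star_D_one]; noncomm_ring
      rw [e]
      -- Inserting `X*W* = 1` on the left and `WX = 1` on the right exposes the commutator of `W*∂W`
      -- with `∂`.
      calc monomial 1 1 * L + -(star X * monomial 1 1 * star W) * monomial 1 1
          = (star X * star W) * monomial 1 1 * L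
            - star X * monomial 1 1 * star W * monomial 1 1 * (W * X) := by
            rw [hXs, hWX]; noncomm_ring
        _ = star X * ((star W * monomial 1 1 * W) * monomial 1 1
            - monomial 1 1 * (star W * monomial 1 1 * W)) * X := by
            rw [hL]; noncomm_ring
        _ = 0 := by rw [hstar.eq, sub_self, mul_zero, zero_mul]
    rw [← coeff_add, key, coeff_zero]

/-! ### The dressing operator of a Riccati solution -/

variable {ι : Type*} [Fintype ι] [DecidableEq ι]

/-- The right hand side of a matrix Riccati equation with coefficients given by the blocks
of `G`. -/
def riccatiRHS (G : Matrix (ι ⊕ ι) (ι ⊕ ι) R) (Φ : Matrix ι ι A) : Matrix ι ι A :=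
  G.toBlocks₂₁.map (algebraMap R A) + G.toBlocks₂₂.map (algebraMap R A) * Φ
    - Φ * G.toBlocks₁₁.map (algebraMap R A) - Φ * G.toBlocks₁₂.map (algebraMap R A) * Φ

/-- The expression is linear in `G` and sandwiched between a row and a column depending on `Φ`
alone. For `G = H^n` this lets the power act on the linearized column. -/
lemma map_C_riccatiRHS (d : Derivation R A A) (G : Matrix (ι ⊕ ι) (ι ⊕ ι) R)
    (Φ : Matrix ι ι A) :
    (riccatiRHS G Φ).map (C d)
      = fromCols (-Φ.map (C d)) (1 : Matrix ι ι (Alg d)) * G.map (scalarHom d) * fromRows (1 : Matrix ι ι (Alg d)) (Φ.map (C d)) := by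
  have hG : G.map (scalarHom d) = fromBlocks (G.toBlocks₁₁.map (scalarHom d))
      (G.toBlocks₁₂.map (scalarHom d)) (G.toBlocks₂₁.map (scalarHom d))
      (G.toBlocks₂₂.map (scalarHom d)) := by
    rw [← fromBlocks_map, fromBlocks_toBlocks]
  rw [hG, fromCols_mul_fromBlocks, fromCols_mul_fromRows, riccatiRHS]
  change (C d).mapMatrix _ = _
  simp only [map_add, map_sub, map_mul, RingHom.mapMatrix_apply, ← map_scalarHom,
    Matrix.add_mul, Matrix.mul_one, Matrix.one_mul, Matrix.neg_mul]
  abel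

/-- The dressing operator `1 - Vᵀ Φ (∂ - B)⁻¹ V`. -/
def dressing (d : Derivation R A A) (B : Matrix ι ι R) (V : ι → R) (Φ : Matrix ι ι A) :
    Matrix Unit Unit (Alg d) :=
  1 - (replicateRow Unit V).map (scalarHom d) * Φ.map (C d) * resolvent d B V

lemma map_vecMulVec_scalarHom (d : Derivation R A A) (V : ι → R) :
    (vecMulVec V V).map (scalarHom d)
      = (replicateCol Unit V).map (scalarHom d) * (replicateRow Unit V).map (scalarHom d) := by
  rw [vecMulVec_eq Unit, Matrix.map_mul]

lemma one_sub_dressing_apply (d : Derivation R A A) (B : Matrix ι ι R) (V : ι → R)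
    (Φ : Matrix ι ι A) :
    1 - dressing d B V Φ () ()
      = ∑ j, ∑ i, C d (algebraMap R A (V i) * Φ i j) * resolvent d B V j () := by
  rw [dressing, Matrix.sub_apply, one_apply_eq, sub_sub_cancel]
  simp only [mul_apply, Finset.sum_mul, map_mul]
  rfl

lemma orderLE_one_sub_dressing (d : Derivation R A A) (B : Matrix ι ι R) (V : ι → R)
    (Φ : Matrix ι ι A) : OrderLE (1 - dressing d B V Φ () ()) (-1) := by
  rw [one_sub_dressing_apply]
  exact orderLE_sum _ _ fun j _ => orderLE_sum _ _ fun i _ =>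
    ((orderLE_monomial _ 0).mul (orderLE_resolvent B V j ())).mono (by omega)

lemma coeff_one_sub_dressing (d : Derivation R A A) (B : Matrix ι ι R) (V : ι → R)
    (Φ : Matrix ι ι A) : (1 - dressing d B V Φ () ()).coeff (-1)
      = ∑ i, ∑ j, algebraMap R A (V i) * Φ i j * algebraMap R A (V j) := by
  rw [one_sub_dressing_apply, coeff_sum, Finset.sum_comm]
  refine Finset.sum_congr rfl fun j _ => ?_
  rw [coeff_sum]
  refine Finset.sum_congr rfl fun i _ => ?_
  rw [C_apply, coeff_C_mul, coeff_resolvent]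
  simp

/-- Only the rank-one form of `q` matters here; the symmetry conditions enter solely in the
reduction. -/
lemma exists_dressing_evolution {d : Derivation R A A} {r q s l : Matrix ι ι R} {V : ι → R}
    (hq : q = vecMulVec V V) {Φ : Matrix ι ι A}
    (hd : Φ.map d = riccatiRHS (fromBlocks r q s l) Φ)
    {δ : Derivation R A A} (hδ : ∀ a, δ (d a) = d (δ a)) {n : ℕ}
    (hn : Φ.map δ = riccatiRHS (fromBlocks r q s l ^ n) Φ) :
    ∃ B ∈ diffOps d, der δ (dressing d r V Φ () ())
      = B * dressing d r V Φ () () - dressing d r V Φ () () * monomial 1 1 ^ n := by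
  set W := dressing d r V Φ with hW
  set f := Φ.map (C d) with hf
  set χ := resolvent d r V with hχ
  set v := (replicateCol Unit V).map (scalarHom d) with hv
  set v' := (replicateRow Unit V).map (scalarHom d) with hv'
  set H := (fromBlocks r q s l).map (scalarHom d) with hH
  have hW1 : W = 1 - v' * f * χ := rfl
  have hH1 : H = fromBlocks (r.map (scalarHom d)) (v * v') (s.map (scalarHom d))
      (l.map (scalarHom d)) := by
    rw [hH, fromBlocks_map, hq, map_vecMulVec_scalarHom]
  have hHn : ((fromBlocks r q s l) ^ n).map (scalarHom d) = H ^ n :=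
    map_pow (scalarHom d).mapMatrix _ n
  have hχ1 : diagD d ι * χ = r.map (scalarHom d) * χ + v := diagD_mul_resolvent r V
  have hfd := diagD_mul_map_C (d := d) Φ
  have hΦd : (Φ.map d).map (C d) = s.map (scalarHom d) + l.map (scalarHom d) * f
      - f * r.map (scalarHom d) - f * (v * v') * f := by
    rw [hd, map_C_riccatiRHS, ← hH, hH1, fromCols_mul_fromBlocks, fromCols_mul_fromRows]
    simp only [Matrix.add_mul, Matrix.mul_one, Matrix.one_mul, Matrix.neg_mul]
    abel
  have hcol := derivative_column_identity hχ1 hfd hΦd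
  -- The linearized system, whose source is a right multiple of `W`.
  have hη : diagD d (ι ⊕ ι) * fromRows χ (f * χ)
      = H * fromRows χ (f * χ) + fromRows v (f * v) * W := by
    rw [diagD, diagonal_mul_fromRows, hH1, fromBlocks_mul_fromRows, fromRows_mul]
    change fromRows (diagD d ι * χ) (diagD d ι * (f * χ)) = _
    rw [hcol, hχ1, hW1]
    have : ∀ a b a' b' : Matrix ι Unit (Alg d),
        fromRows a b + fromRows a' b' = fromRows (a + a') (b + b') := by
      intro a b a' b'; ext (i | i) j <;> rfl
    rw [this]
    congr 1
    simp only [Matrix.mul_sub, Matrix.mul_one, Matrix.mul_assoc]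
    abel
  have hHmem : ∀ i j, H i j ∈ diffOps d := fun i j => C_mem_diffOps _
  have hvmem : ∀ i j, v i j ∈ diffOps d := fun i j => C_mem_diffOps _
  have hv'mem : ∀ i j, v' i j ∈ diffOps d := fun i j => C_mem_diffOps _
  have hfmem : ∀ i j, f i j ∈ diffOps d := fun i j => C_mem_diffOps _
  obtain ⟨E, hE, hEn⟩ := exists_pow_mul_eq
    (diagonal_mul_map_scalarHom (monomial 1 1) (fromBlocks r q s l)) (diffOps d)
    (fun i j => by
      rw [diagonal_apply]
      split_ifs
      exacts [monomial_mem_diffOps 1 (by omega), Subring.zero_mem _])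
    hHmem (ζ := fromRows v (f * v))
    (by rintro (i | i) j; exacts [hvmem i j, mul_apply_mem hfmem hvmem i j]) hη n
  set U := fromCols (-f) (1 : Matrix ι ι (Alg d)) with hU
  have hUmem : ∀ i j, U i j ∈ diffOps d := by
    rintro i (j | j)
    · exact Subring.neg_mem _ (hfmem i j)
    · change (1 : Matrix ι ι (Alg d)) i j ∈ _
      rw [one_apply]
      split_ifs
      exacts [Subring.one_mem _, Subring.zero_mem _]
  let p : Matrix Unit Unit (Alg d) := diagonal fun _ => monomial 1 1 ^ n
  let Dn : Matrix ι ι (Alg d) := diagonal fun _ => monomial 1 1 ^ n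
  have hχn : Dn * χ = χ * p :=
    diagonal_mul_of_der_eq_zero (fun i j => der_resolvent d r V i j) n
  have hv'n : p * v' = v' * Dn := diagonal_mul_map_scalarHom _ _
  have hder : W.map (der δ) = -(v' * (U * (H ^ n * fromRows χ (f * χ)))) := by
    have h1 : W.map (der δ) = -((v' * f * χ).map (der δ)) := by
      ext1 i j
      rw [hW1, Matrix.map_apply, Matrix.sub_apply, map_sub, Matrix.neg_apply, Matrix.map_apply,
        sub_eq_neg_self]
      rw [Subsingleton.elim i j, one_apply_eq, one_def, der_monomial, δ.map_one_eq_zero]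
      exact map_zero (C d)
    have hχ0 : χ.map (der δ) = 0 := by ext1 i j; exact der_resolvent δ r V i j
    have h2 : fromRows χ (f * χ) = fromRows (1 : Matrix ι ι (Alg d)) f * χ := by
      rw [fromRows_mul, Matrix.one_mul]
    rw [h1, map_der_mul hδ, map_der_mul hδ, hχ0, map_der_map_scalarHom, map_der_map_C, hn,
      map_C_riccatiRHS, hHn, h2]
    simp only [Matrix.zero_mul, zero_add, Matrix.mul_zero, add_zero, Matrix.mul_assoc]
    rfl
  -- Replacing `Hⁿη` by `∂ⁿη - EW`: as `∂ⁿ` commutes with `χ` and `v'`, the first term gives `∂ⁿW -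
  -- W∂ⁿ`, and the second adds `v'UE` to the differential operator on the left of `W`.
  have hfin : W.map (der δ) = (p + v' * (U * E)) * W - W * p := by
    have h1 : H ^ n * fromRows χ (f * χ)
        = fromRows (Dn * χ) (Dn * (f * χ)) - E * W := by
      rw [eq_sub_iff_add_eq, ← hEn, ← diagonal_mul_fromRows]
      exact congrArg (· * _) (diagD_pow (ι ⊕ ι) n)
    rw [hder, h1, hU, Matrix.mul_sub, fromCols_mul_fromRows, hχn, ← hU, Matrix.add_mul,
      Matrix.mul_sub]
    have h2 : p * W - W * p = v' * (f * (χ * p)) - v' * (Dn * (f * χ)) := by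
      rw [hW1, Matrix.mul_sub, Matrix.sub_mul, ← Matrix.mul_assoc p, ← Matrix.mul_assoc p, hv'n]
      simp only [Matrix.mul_one, Matrix.one_mul, Matrix.mul_assoc]
      abel
    rw [add_sub_right_comm, h2]
    simp only [Matrix.mul_add, Matrix.neg_mul, Matrix.one_mul, Matrix.mul_neg, Matrix.mul_assoc]
    abel
  refine ⟨(p + v' * (U * E)) () (), ?_, ?_⟩
  · rw [Matrix.add_apply]
    refine Subring.add_mem _ ?_ (mul_apply_mem hv'mem (mul_apply_mem hUmem hE) () ())
    change diagonal _ () () ∈ _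
    rw [diagonal_apply_eq]
    exact Subring.pow_mem _ (monomial_mem_diffOps 1 (by omega)) n
  · have h := congrFun (congrFun hfin ()) ()
    rw [Matrix.map_apply, Matrix.sub_apply, mul_apply, mul_apply, Fintype.sum_unique,
      Fintype.sum_unique] at h
    have hp : p () () = monomial 1 1 ^ n := diagonal_apply_eq _ _
    rwa [hp] at h

lemma commute_star_dressing {d : Derivation R A A} {s l : Matrix ι ι R} {V : ι → R}
    (hs : sᵀ = s) {Φ : Matrix ι ι A}
    (hd : Φ.map d = riccatiRHS (fromBlocks (-lᵀ) (vecMulVec V V) s l) Φ)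
    (hB : s.map (algebraMap R A) + l.map (algebraMap R A) * Φ + Φᵀ * lᵀ.map (algebraMap R A)
      - Φᵀ * (vecMulVec V V).map (algebraMap R A) * Φ = 0) :
    Commute (monomial 1 1) (star (dressing d (-lᵀ) V Φ () ()) * monomial 1 1
      * dressing d (-lᵀ) V Φ () ()) := by
  set W := dressing d (-lᵀ) V Φ with hW
  set f := Φ.map (C d) with hf
  set g := Φᵀ.map (C d) with hg
  set χ := resolvent d (-lᵀ) V with hχ
  set v := (replicateCol Unit V).map (scalarHom d) with hv
  set v' := (replicateRow Unit V).map (scalarHom d) with hv'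
  set q := (vecMulVec V V).map (algebraMap R A) with hq
  have hqv : q.map (C d) = v * v' := map_vecMulVec_scalarHom d V
  have hW1 : W = 1 - v' * f * χ := rfl
  have hvt : vᴴ = v' := by
    ext1 i j; exact star_C _
  have hv't : v'ᴴ = v := by
    ext1 i j; exact star_C _
  have hft : fᴴ = g := by
    ext1 i j; exact star_C _
  have hlt : (lᵀ.map (scalarHom d))ᴴ = l.map (scalarHom d) := by
    ext1 i j; exact star_C _
  have hWs : Wᴴ = 1 - χᴴ * g * v := by
    rw [hW1, conjTranspose_sub, conjTranspose_one, conjTranspose_mul, conjTranspose_mul, hft, hv't,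
      Matrix.mul_assoc]
  have hneg : (-lᵀ).map (scalarHom d) = -lᵀ.map (scalarHom d) :=
    map_neg (scalarHom d).mapMatrix lᵀ
  have hχ1 : diagD d ι * χ = -lᵀ.map (scalarHom d) * χ + v := by
    rw [← hneg]; exact diagD_mul_resolvent _ V
  have hχs : χᴴ * diagD d ι = χᴴ * l.map (scalarHom d) - v' := by
    have h := congrArg conjTranspose hχ1
    rw [conjTranspose_mul, conjTranspose_add, conjTranspose_mul, conjTranspose_neg, hlt, hvt,
      conjTranspose_diagD, Matrix.mul_neg, Matrix.mul_neg] at h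
    rw [← neg_inj, h]
    abel
  have hχp : diagD d ι * χ = χ * diagD d Unit :=
    diagD_mul_of_der_eq_zero fun i j => der_resolvent d (-lᵀ) V i j
  have hχsp : diagD d Unit * χᴴ = χᴴ * diagD d ι := by
    have h := congrArg conjTranspose hχp
    rw [conjTranspose_mul, conjTranspose_mul, conjTranspose_diagD, conjTranspose_diagD, Matrix.mul_neg, Matrix.neg_mul,
      neg_inj] at h
    exact h.symm
  have hd' : Φ.map d = s.map (algebraMap R A) + l.map (algebraMap R A) * Φ
      + Φ * lᵀ.map (algebraMap R A) - Φ * q * Φ := by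
    have : (-lᵀ).map (algebraMap R A) = -lᵀ.map (algebraMap R A) :=
      map_neg (algebraMap R A).mapMatrix lᵀ
    rw [hd, riccatiRHS, toBlocks_fromBlocks₁₁, toBlocks_fromBlocks₁₂, toBlocks_fromBlocks₂₁,
      toBlocks_fromBlocks₂₂, this, Matrix.mul_neg, sub_neg_eq_add]
  have hqt : qᵀ = q := by
    ext1 i j
    simp [hq, vecMulVec_apply, mul_comm]
  have hdt : Φᵀ.map d = s.map (algebraMap R A) + l.map (algebraMap R A) * Φᵀ
      + Φᵀ * lᵀ.map (algebraMap R A) - Φᵀ * q * Φᵀ := by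
    have h := congrArg transpose hd'
    rw [transpose_sub, transpose_add, transpose_add, transpose_mul, transpose_mul, transpose_mul,
      transpose_mul, hqt, ← transpose_map, ← transpose_map, ← transpose_map, ← transpose_map, hs,
      transpose_transpose] at h
    rw [h, Matrix.mul_assoc]
    abel
  have hCd : (Φ.map d).map (C d) = s.map (scalarHom d) + l.map (scalarHom d) * f
      + f * lᵀ.map (scalarHom d) - f * (v * v') * f := by
    rw [hd', ← hqv]
    exact (map_sub (C d).mapMatrix _ _).trans (by
      simp only [map_add, map_mul, RingHom.mapMatrix_apply, ← map_scalarHom]; rfl)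
  have hCdt : (Φᵀ.map d).map (C d) = s.map (scalarHom d) + l.map (scalarHom d) * g
      + g * lᵀ.map (scalarHom d) - g * (v * v') * g := by
    rw [hdt, ← hqv]
    exact (map_sub (C d).mapMatrix _ _).trans (by
      simp only [map_add, map_mul, RingHom.mapMatrix_apply, ← map_scalarHom]; rfl)
  have hCB : s.map (scalarHom d) + l.map (scalarHom d) * f
      + g * lᵀ.map (scalarHom d) - g * (v * v') * f = 0 := by
    rw [← hqv]
    refine Eq.trans ?_ ((congrArg (C d).mapMatrix hB).trans (map_zero _))
    simp only [map_add, map_sub, map_mul, RingHom.mapMatrix_apply, ← map_scalarHom]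
    rfl
  -- A `1 × 1` matrix over the commutative algebra equals its transpose.
  have hsym : v' * f * v = v' * g * v := by
    have e : ∀ M : Matrix ι ι A, v' * M.map (C d) * v
        = ((replicateRow Unit V).map (algebraMap R A) * M
          * (replicateCol Unit V).map (algebraMap R A)).map (C d) := fun M => by
      rw [Matrix.map_mul, Matrix.map_mul, ← map_scalarHom, ← map_scalarHom]
    rw [hf, hg, e, e]
    congr 1
    ext1 i j
    have : ((replicateRow Unit V).map (algebraMap R A) * Φ
        * (replicateCol Unit V).map (algebraMap R A))ᵀ
        = (replicateRow Unit V).map (algebraMap R A) * Φᵀ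
          * (replicateCol Unit V).map (algebraMap R A) := by
      rw [transpose_mul, transpose_mul, ← Matrix.mul_assoc]
      rfl
    rw [← this]
    rfl
  have hvp : diagD d ι * v = v * diagD d Unit := diagonal_mul_map_scalarHom _ _
  have hv'p : diagD d Unit * v' = v' * diagD d ι := diagonal_mul_map_scalarHom _ _
  have hsp : diagD d ι * s.map (scalarHom d) = s.map (scalarHom d) * diagD d ι :=
    diagonal_mul_map_scalarHom _ _
  have hG := conjugated_derivative_identity hχ1 hχs hvp hv'p (diagonal_mul_map_scalarHom _ _)
    (diagD_mul_map_C Φ) (diagD_mul_map_C Φᵀ) hCd hCdt hCB hsym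
  rw [← hW1, ← hWs] at hG
  -- By `hG` the operator is `∂ + χ*s∂χ`, and `∂` passes through each factor because `χ`, `χ*` and
  -- `s` have constant coefficients.
  have hcomm : diagD d Unit * (Wᴴ * diagD d Unit * W) = Wᴴ * diagD d Unit * W * diagD d Unit := by
    rw [hG, Matrix.mul_add, Matrix.add_mul]
    congr 1
    have h2 : diagD d ι * (diagD d ι * χ) = diagD d ι * χ * diagD d Unit := by
      rw [hχp, ← Matrix.mul_assoc, hχp]
    calc diagD d Unit * (χᴴ * s.map (scalarHom d) * (diagD d ι * χ))
        = diagD d Unit * χᴴ * s.map (scalarHom d) * (diagD d ι * χ) := by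
          simp only [Matrix.mul_assoc]
      _ = χᴴ * (diagD d ι * s.map (scalarHom d)) * (diagD d ι * χ) := by
          rw [hχsp]; simp only [Matrix.mul_assoc]
      _ = χᴴ * s.map (scalarHom d) * (diagD d ι * (diagD d ι * χ)) := by
          rw [hsp]; simp only [Matrix.mul_assoc]
      _ = _ := by rw [h2]; simp only [Matrix.mul_assoc]
  have h := congrFun (congrFun hcomm ()) ()
  simp only [mul_apply, Fintype.sum_unique] at h
  exact h

/-- Solutions of the odd matrix Riccati hierarchy with the symmetry reduction of type B give
solutions of the BKP hierarchy. -/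
theorem exists_isBKPLax_of_riccati (δ : OddIdx → Derivation R A A)
    (hδ : ∀ n a, δ n (δ ⟨1, odd_one⟩ a) = δ ⟨1, odd_one⟩ (δ n a))
    {s l : Matrix ι ι R} {V : ι → R} (hs : sᵀ = s) {Φ : Matrix ι ι A}
    (hΦ : ∀ n : OddIdx, Φ.map (δ n)
      = riccatiRHS (fromBlocks (-lᵀ) (vecMulVec V V) s l ^ (n : ℕ)) Φ)
    (hB : s.map (algebraMap R A) + l.map (algebraMap R A) * Φ + Φᵀ * lᵀ.map (algebraMap R A)
      - Φᵀ * (vecMulVec V V).map (algebraMap R A) * Φ = 0) :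
    ∃ L : PsiDO A, IsBKPLax δ
      (∑ i, ∑ j, algebraMap R A (V i) * Φ i j * algebraMap R A (V j)) L := by
  have hd : Φ.map (δ ⟨1, odd_one⟩)
      = riccatiRHS (fromBlocks (-lᵀ) (vecMulVec V V) s l) Φ := by
    have h := hΦ ⟨1, odd_one⟩
    rwa [pow_one] at h
  exact exists_isBKPLax_of_dressing rfl hδ (orderLE_one_sub_dressing _ (-lᵀ) V Φ)
    (coeff_one_sub_dressing _ (-lᵀ) V Φ)
    (fun n => exists_dressing_evolution rfl hd (hδ n) (hΦ n))
    (commute_star_dressing hs hd hB)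

end Dressing

/-! ### Symmetry of mixed partial derivatives -/

section MixedPartials

variable {𝕜 F : Type*} [RCLike 𝕜] [RCLike F] [NormedAlgebra 𝕜 F] {U : TimeDomain 𝕜}

/-- Near a point, partial derivatives are Fréchet derivatives in finitely many variables. -/
lemma eventually_extZero_partialDeriv_shift {f : U.carrier → F} (hf : IsSmooth U f)
    {t : Times 𝕜} (ht : t ∈ U.carrier) {s : Finset OddIdx} (n : s) :
    ∀ᶠ x in 𝓝 (0 : s → 𝕜), extZero U (partialDeriv U n f) (shift t s x)
      = fderiv 𝕜 (fun y : s → 𝕜 => extZero U f (shift t s y)) x (Pi.single n 1) := by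
  classical
  have hdiff : ∀ᶠ y in 𝓝 (0 : s → 𝕜),
      DifferentiableAt 𝕜 (fun y : s → 𝕜 => extZero U f (shift t s y)) y :=
    (((hf t ht s).of_le (m := 1) (by simp)).eventually (by simp)).mono
      fun y hy => hy.differentiableAt (by simp)
  filter_upwards [U.isOpen_finite t ht s, hdiff] with x hx hd
  rw [extZero_apply U _ hx, ← hd.lineDeriv_eq_fderiv]
  change lineDeriv 𝕜 (extZero U f) (shift t s x) (Pi.single (n : OddIdx) 1) = _
  rw [lineDeriv, lineDeriv]
  congr 1
  funext r
  congr 1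
  funext m
  by_cases hm : m = n
  · subst hm
    simp [shift, add_assoc]
  · by_cases hs : m ∈ s
    · have : (⟨m, hs⟩ : s) ≠ n := fun h => hm (by rw [← h])
      simp [shift, hs, hm, this]
    · simp [shift, hs, hm]

/-- Partial derivatives of smooth functions commute. -/
lemma dt_comm (m n : OddIdx) (f : SmoothFun F U) :
    dt F U m (dt F U n f) = dt F U n (dt F U m f) := by
  classical
  ext t
  -- Only two directions matter, so the claim reduces to the symmetry of the second Fréchet
  -- derivative at `0` of a function of finitely many variables.
  let s : Finset OddIdx := {m, n}
  let g : (s → 𝕜) → F := fun y => extZero U f.1 (shift (t : Times 𝕜) s y)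
  have hg : ContDiffAt 𝕜 ∞ g 0 := f.2 t t.2 s
  have hdiff : DifferentiableAt 𝕜 (fderiv 𝕜 g) 0 :=
    (hg.fderiv_right (m := ∞) (by simp)).differentiableAt (by simp)
  have key : ∀ a b : s, partialDeriv U a (partialDeriv U b f.1) t
      = fderiv 𝕜 (fderiv 𝕜 g) 0 (Pi.single a 1) (Pi.single b 1) := by
    intro a b
    have h1 := (eventually_extZero_partialDeriv_shift (f.2.partialDeriv b) t.2 a).self_of_nhds
    rw [shift_zero, extZero_apply U _ t.2] at h1
    have h2 := Filter.EventuallyEq.fderiv_eq (𝕜 := 𝕜)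
      (eventually_extZero_partialDeriv_shift f.2 t.2 b)
    refine h1.trans ?_
    rw [h2]
    change fderiv 𝕜 (fun x => fderiv 𝕜 g x (Pi.single b 1)) 0 (Pi.single a 1) = _
    rw [fderiv_clm_apply hdiff (by fun_prop)]
    simp
  change partialDeriv U m (partialDeriv U n f.1) t = partialDeriv U n (partialDeriv U m f.1) t
  have hm : m ∈ s := by simp [s]
  have hn : n ∈ s := by simp [s]
  exact (key ⟨m, hm⟩ ⟨n, hn⟩).trans (((hg.isSymmSndFDerivAt
    (by rw [minSmoothness_of_isRCLikeNormedField]; exact WithTop.coe_le_coe.2 le_top)).eq _ _).trans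
    (key ⟨n, hn⟩ ⟨m, hm⟩).symm)

end MixedPartials

end BKP

end

/-- The algebraic theorem is applied with scalars `F` and the algebra of smooth functions. The
double sum is `VᵀΦV`, and the hypothesis `hΦ` agrees definitionally with the form using
`riccatiRHS`. -/
theorem proposition5p3 {𝕜 F : Type*} [RCLike 𝕜] [RCLike F] [NormedAlgebra 𝕜 F]
    (U : BKP.TimeDomain 𝕜) (N : ℕ)
    (L Q R S : Matrix (Fin N) (Fin N) F) (V : Fin N → F)
    (hR : R = -L.transpose) (hS : S = S.transpose) (hQ : Q = Matrix.vecMulVec V V)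
    (Φ : Matrix (Fin N) (Fin N) (BKP.SmoothFun F U))
    (hΦ : BKP.SolvesOddRiccati L Q R S Φ)
    (hB : BKP.constMatrix U S + BKP.constMatrix U L * Φ
        + Φ.transpose * BKP.constMatrix U L.transpose
        - Φ.transpose * BKP.constMatrix U Q * Φ = 0) :
    BKP.SolvesBKPHierarchy
      (∑ i, ∑ j, algebraMap F (BKP.SmoothFun F U) (V i) * Φ i j
        * algebraMap F (BKP.SmoothFun F U) (V j)) := by
  subst hR hQ
  exact BKP.exists_isBKPLax_of_riccati (BKP.dt F U) (fun n f => BKP.dt_comm n _ f) hS.symm hΦ hB
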